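/- Let $M$ be a connected smooth manifold. A Finsler spacetime $(M,L)$ consists of a connected open conic set $A\subset TM\setminus\mathbf 0$ with smooth boundary and with $A_p=A\cap T_pM\neq\emptyset$ for all $p$, and of a smooth function $L\colon\bar A\to[0,\infty)$ on the closure $\bar A$ of $A$ in $TM\setminus\mathbf 0$, such that $L(\lambda v)=\lambda^2L(v)$ for $\lambda>0$, the fundamental tensor $g_v(u,w)=\frac12\frac{\partial^2}{\partial s\partial t}L(v+tu+sw)|_{t=s=0}$ has signature $(+,-,\dots,-)$ for every $v\in\bar A$, and the boundary of $\bar A$ in $TM\setminus\mathbf 0$ is $L^{-1}(0)$. Let $C_v(u,w,z)=\frac14\frac{\partial^3}{\partial r\partial s\partial t}L(v+tu+sw+rz)|_{t=s=r=0}$ be the Cartan tensor. For an open set $\mathscr U\subseteq M$ and a smooth vector field $V$ on $\mathscr U$ with values in $\bar A$, the Levi-Civita–Chern connection $\nabla^V$ is the unique torsion-free affine connection on $\mathscr U$ with $$X(g_V(Y,Z))=g_V(\nabla^V_XY,Z)+g_V(Y,\nabla^V_XZ)+2C_V(\nabla^V_XV,Y,Z)\quad\text{for all }X,Y,Z\in\mathfrak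 X(\mathscr U).$$ Let $f\colon\mathscr U\to\mathbb R$ be smooth and let $N=\nabla f$ be its gradient, i.e. $N$ is a smooth vector field on $\mathscr U$ with values in $\bar A$ and $g_N(N,X)=df(X)$ for all $X\in\mathfrak X(\mathscr U)$. Suppose that $N$ is lightlike ($L(N)=0$) and parallel ($\nabla^N_XN=0$ for all $X\in\mathfrak X(\mathscr U)$). Let $N^\perp\subseteq T\mathscr U$ be the $g_N$-orthogonal complement of $N$. Then: 1. the vector bundle $N^\perp/N$ over $\mathscr U$ carries a well-defined smooth positive-definite metric $\bar g([X],[Y]):=-g_N(X,Y)$; 2. $N^\perp/N$ carries a well-defined linear connection $\overline\nabla\colon\mathfrak X(\mathscr U)\times\Gamma(N^\perp/N)\to\Gamma(N^\perp/N)$, $\overline\nabla_W[Y]:=[\nabla^N_WY]$ (in particular $\nabla^N_WY\in\Gamma(N^\perp)$ for all $W\in\mathfrak X(\mathscr U)$ and $Y\in\Gamma(N^\perp)$); 3. $\overline\nabla$ is flat if and only if $(\mathscr U,L|_{\mathscr U})$ is a Finsler pp-wave with respect to $N$, that is, the curvature $R_N$ satisfies $R_N(X,Y)Z=0$ for all $X,Y,Z\in\Gamma(N^\perp)$.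 (Since $N$ is parallel, the Chern curvature $R_N$ at $N$ is the curvature tensor of $\nabla^N$.) -/

import Mathlib

open Bundle Set TopologicalSpace
open scoped Manifold ContDiff Topology

noncomputable section

namespace FinslerPP

section Cone

variable {E : Type*} [NormedAddCommGroup E] [NormedSpace ℝ E]
  {M : Type*} [TopologicalSpace M] [ChartedSpace E M]
  [IsManifold 𝓘(ℝ, E) ∞ M]

/-- The closure of a set `A ⊆ TM ∖ 0` of tangent vectors, taken in the slit tangent bundle
`TM ∖ 0`. -/
def slitClosure (A : Set (TangentBundle 𝓘(ℝ, E) M)) : Set (TangentBundle 𝓘(ℝ, E) M) :=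
  closure A \ {v | v.2 = 0}

/-- The fundamental tensor `g_v(u, w) = ½ ∂²/∂s∂t L(v + t u + s w)` at `t = s = 0`, written as half
the second derivative of `L` on the tangent space `T_{π(v)}M` (which is modelled on `E`). -/
def fundamentalTensor (L : TangentBundle 𝓘(ℝ, E) M → ℝ) (v : TangentBundle 𝓘(ℝ, E) M) :
    E →L[ℝ] E →L[ℝ] ℝ :=
  (1 / 2 : ℝ) • fderiv ℝ (fderiv ℝ (fun y : E => L ⟨v.1, y⟩)) v.2

/-- The Cartan tensor `C_v(u, w, z) = ¼ ∂³/∂r∂s∂t L(v + t u + s w + r z)` at `t = s = r = 0`. -/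
def cartanTensor (L : TangentBundle 𝓘(ℝ, E) M → ℝ) (v : TangentBundle 𝓘(ℝ, E) M) :
    E →L[ℝ] E →L[ℝ] E →L[ℝ] ℝ :=
  (1 / 4 : ℝ) • fderiv ℝ (fderiv ℝ (fderiv ℝ (fun y : E => L ⟨v.1, y⟩))) v.2

/-- A bilinear form has signature `(+, -, …, -)`: it is positive on some vector and negative
definite on the orthogonal complement of that vector. -/
def HasLorentzSignature (b : E →L[ℝ] E →L[ℝ] ℝ) : Prop :=
  ∃ u, 0 < b u u ∧ ∀ w, b u w = 0 → w ≠ 0 → b w w < 0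

end Cone

/-- A Finsler spacetime `(M, L)`: a connected open cone `A ⊆ TM ∖ 0` with smooth boundary and
nonempty fibres, and a nonnegative smooth function `L` on its closure `Ā` in `TM ∖ 0`, positively
homogeneous of degree two, whose fundamental tensor has signature `(+, -, …, -)` on `Ā` and whose
zero set is the boundary of `Ā`.

The function `L` is recorded together with a smooth extension to an open neighbourhood of `Ā`
(smoothness on the manifold with boundary `Ā` means that there is one). Apart from the existence of
the extension, only the values on `Ā` are constrained, and the derivatives of `L` at points of `Ā`
do not depend on the extension. -/
structure FinslerSpacetime (E : Type*) [NormedAddCommGroup E] [NormedSpace ℝ E]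
    (M : Type*) [TopologicalSpace M] [ChartedSpace E M] [IsManifold 𝓘(ℝ, E) ∞ M] where
  A : Set (TangentBundle 𝓘(ℝ, E) M)
  L : TangentBundle 𝓘(ℝ, E) M → ℝ
  isOpen_A : IsOpen A
  isConnected_A : IsConnected A
  ne_zero : ∀ v ∈ A, v.2 ≠ 0
  conic : ∀ v ∈ A, ∀ c : ℝ, 0 < c → (⟨v.1, c • v.2⟩ : TangentBundle 𝓘(ℝ, E) M) ∈ A
  nonempty_fibre : ∀ p : M, ∃ v ∈ A, v.1 = p
  /-- Near each of its boundary points in `TM ∖ 0`, the set `A` is `{φ > 0}` for a smooth function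
  `φ` whose differential does not vanish at the point. -/
  smooth_boundary : ∀ v ∈ slitClosure A \ A,
    ∃ (W : Set (TangentBundle 𝓘(ℝ, E) M)) (φ : TangentBundle 𝓘(ℝ, E) M → ℝ),
      IsOpen W ∧ v ∈ W ∧ ContMDiffOn 𝓘(ℝ, E).tangent 𝓘(ℝ, ℝ) ∞ φ W ∧
      mfderiv 𝓘(ℝ, E).tangent 𝓘(ℝ, ℝ) φ v ≠ 0 ∧ ∀ w ∈ W, w ∈ A ↔ 0 < φ w
  smooth_L : ∃ Ω : Set (TangentBundle 𝓘(ℝ, E) M), IsOpen Ω ∧ slitClosure A ⊆ Ω ∧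
    ContMDiffOn 𝓘(ℝ, E).tangent 𝓘(ℝ, ℝ) ∞ L Ω
  nonneg_L : ∀ v ∈ slitClosure A, 0 ≤ L v
  homogeneous_L : ∀ v ∈ slitClosure A, ∀ c : ℝ, 0 < c → L ⟨v.1, c • v.2⟩ = c ^ 2 * L v
  signature : ∀ v ∈ slitClosure A, HasLorentzSignature (fundamentalTensor L v)
  lightcone : ∀ v ∈ slitClosure A, L v = 0 ↔ v ∈ frontier (slitClosure A)

section Fields

variable {E : Type*} [NormedAddCommGroup E] [NormedSpace ℝ E]
  {M : Type*} [TopologicalSpace M] [ChartedSpace E M] [IsManifold 𝓘(ℝ, E) ∞ M]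

/-- The functions that are smooth on `U`, as a subalgebra of all functions on `M`. -/
def smoothSubalgebra (E : Type*) [NormedAddCommGroup E] [NormedSpace ℝ E]
    {M : Type*} [TopologicalSpace M] [ChartedSpace E M] (U : Opens M) : Subalgebra ℝ (M → ℝ) where
  carrier := {f | ContMDiffOn 𝓘(ℝ, E) 𝓘(ℝ, ℝ) ∞ f U}
  mul_mem' hf hg := ContMDiffOn.mul hf hg
  add_mem' hf hg := ContMDiffOn.add hf hg
  algebraMap_mem' _ := contMDiffOn_const

/-- The ring of smooth functions on `U`. Its elements are functions on `M` that are smooth on `U`;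
their values outside `U` play no role. -/
def SmoothFun (E : Type*) [NormedAddCommGroup E] [NormedSpace ℝ E]
    {M : Type*} [TopologicalSpace M] [ChartedSpace E M] (U : Opens M) : Type _ :=
  smoothSubalgebra E U

instance (U : Opens M) : CommRing (SmoothFun E U) :=
  inferInstanceAs (CommRing (smoothSubalgebra E U))

instance (U : Opens M) : FunLike (SmoothFun E U) M ℝ where
  coe := Subtype.val
  coe_injective := Subtype.val_injective

/-- The smooth vector fields on `U`, extended by zero to `M`, as an additive group. -/
def fieldSubgroup (E : Type*) [NormedAddCommGroup E] [NormedSpace ℝ E]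
    {M : Type*} [TopologicalSpace M] [ChartedSpace E M] [IsManifold 𝓘(ℝ, E) ∞ M] (U : Opens M) :
    AddSubgroup ((p : M) → TangentSpace 𝓘(ℝ, E) p) where
  carrier := {X | ContMDiffOn 𝓘(ℝ, E) 𝓘(ℝ, E).tangent ∞
      (fun p => (⟨p, X p⟩ : TangentBundle 𝓘(ℝ, E) M)) U ∧ ∀ p ∉ U, X p = 0}
  add_mem' {X Y} hX hY :=
    ⟨hX.1.add_section hY.1, fun p hp => by simp [hX.2 p hp, hY.2 p hp]⟩
  zero_mem' := ⟨(contMDiff_zeroSection ℝ (TangentSpace 𝓘(ℝ, E) : M → Type _) (F := E)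
      (IB := 𝓘(ℝ, E)) (n := ∞)).contMDiffOn, fun p _ => rfl⟩
  neg_mem' {X} hX := ⟨hX.1.neg_section, fun p hp => by simp [hX.2 p hp]⟩

/-- The space `𝔛(U)` of smooth vector fields on `U`. A vector field on `U` is represented by its
extension by zero to `M`. -/
def VectorFields (E : Type*) [NormedAddCommGroup E] [NormedSpace ℝ E]
    {M : Type*} [TopologicalSpace M] [ChartedSpace E M] [IsManifold 𝓘(ℝ, E) ∞ M] (U : Opens M) :
    Type _ :=
  fieldSubgroup E U

instance (U : Opens M) : AddCommGroup (VectorFields E U) :=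
  inferInstanceAs (AddCommGroup (fieldSubgroup E U))

instance (U : Opens M) : DFunLike (VectorFields E U) M (TangentSpace 𝓘(ℝ, E)) where
  coe := Subtype.val
  coe_injective := Subtype.val_injective

theorem VectorFields.contMDiffOn {U : Opens M} (X : VectorFields E U) :
    ContMDiffOn 𝓘(ℝ, E) 𝓘(ℝ, E).tangent ∞
      (fun p => (⟨p, X p⟩ : TangentBundle 𝓘(ℝ, E) M)) U := X.2.1

theorem VectorFields.eq_zero {U : Opens M} (X : VectorFields E U) (p : M) (hp : p ∉ U) :
    X p = 0 := X.2.2 p hp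

/-- Smooth functions on `U` act on vector fields on `U` by pointwise multiplication. -/
instance (U : Opens M) : SMul (SmoothFun E U) (VectorFields E U) where
  smul f X := ⟨fun p => f p • X p, ContMDiffOn.smul_section f.2 X.contMDiffOn, fun p hp => by
    simp [X.eq_zero p hp]⟩

instance (U : Opens M) : Module (SmoothFun E U) (VectorFields E U) where
  one_smul X := DFunLike.ext _ _ (fun p => one_smul ℝ (X p))
  mul_smul f f' X := DFunLike.ext _ _ (fun p => mul_smul (f p) (f' p) (X p))
  smul_zero f := DFunLike.ext _ _ (fun p => smul_zero (f p))
  smul_add f X Y := DFunLike.ext _ _ (fun p => smul_add (f p) (X p) (Y p))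
  add_smul f f' X := DFunLike.ext _ _ (fun p => add_smul (f p) (f' p) (X p))
  zero_smul X := DFunLike.ext _ _ (fun p => zero_smul ℝ (X p))

/-- The derivative `X(f) = df(X)`. -/
def dirDeriv {U : Opens M} (X : VectorFields E U) (f : SmoothFun E U) : SmoothFun E U :=
  ⟨fun p => mfderiv 𝓘(ℝ, E) 𝓘(ℝ, ℝ) f p (X p), by
    have hU : UniqueMDiffOn 𝓘(ℝ, E) (U : Set M) := U.isOpen.uniqueMDiffOn
    have h1 := ContMDiffOn.contMDiffOn_tangentMapWithin (m := ∞) (n := ∞) f.2 (by simp) hU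
    have h2 := h1.comp X.contMDiffOn (fun p hp => hp)
    have h3 := (contMDiff_snd_tangentBundle_modelSpace ℝ 𝓘(ℝ, ℝ) (n := ∞)).comp_contMDiffOn h2
    refine h3.congr fun p hp => ?_
    exact congrArg (fun T : TangentSpace 𝓘(ℝ, E) p →L[ℝ] ℝ => T (X p))
      (mfderivWithin_of_isOpen U.isOpen hp).symm⟩

variable [FiniteDimensional ℝ E]

/-- The Lie bracket `[X, Y]` of smooth vector fields on `U`. -/
def lieBracket {U : Opens M} (X Y : VectorFields E U) : VectorFields E U :=
  ⟨fun p => open Classical in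
      if p ∈ U then VectorField.mlieBracket 𝓘(ℝ, E) X Y p else 0, by
    have : IsManifold 𝓘(ℝ, E) (((⊤ : ℕ∞) : WithTop ℕ∞) + 1) M := by simpa
    have : IsManifold 𝓘(ℝ, E) (minSmoothness ℝ 2) M :=
      IsManifold.of_le (n := ∞) (by
        rw [minSmoothness_of_isRCLikeNormedField]
        exact WithTop.coe_le_coe.2 (le_top : (2 : ℕ∞) ≤ ⊤))
    have : CompleteSpace E := FiniteDimensional.complete ℝ E
    have h := ContMDiffOn.mlieBracketWithin_vectorField (m := (⊤ : ℕ∞)) (n := (⊤ : ℕ∞))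
      X.contMDiffOn Y.contMDiffOn U.isOpen.uniqueMDiffOn (by simp)
    refine ⟨h.congr fun p hp => ?_, fun p hp => by simp [hp]⟩
    have hp' : p ∈ U := hp
    simp [hp', VectorField.mlieBracketWithin_of_isOpen U.isOpen hp]⟩

/-- `D` is a linear connection on a module `Γ` of sections over `U`: `D_W s` is linear over the
smooth functions in `W`, additive in `s`, and satisfies the Leibniz rule. -/
structure IsLinearConnection {U : Opens M} {Γ : Type*} [AddCommGroup Γ]
    [Module (SmoothFun E U) Γ] (D : VectorFields E U → Γ → Γ) : Prop where
  add_left : ∀ W W' s, D (W + W') s = D W s + D W' s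
  smul_left : ∀ (f : SmoothFun E U) W s, D (f • W) s = f • D W s
  add_right : ∀ W s s', D W (s + s') = D W s + D W s'
  leibniz : ∀ W (f : SmoothFun E U) s, D W (f • s) = f • D W s + dirDeriv W f • s

/-- The curvature `R(X, Y)s = D_X D_Y s - D_Y D_X s - D_{[X, Y]} s`. -/
def curvature {U : Opens M} {Γ : Type*} [AddCommGroup Γ]
    (D : VectorFields E U → Γ → Γ) (X Y : VectorFields E U) (s : Γ) : Γ :=
  D X (D Y s) - D Y (D X s) - D (lieBracket X Y) s

/-- A connection is flat if its curvature vanishes. -/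
def IsFlat {U : Opens M} {Γ : Type*} [AddCommGroup Γ]
    (D : VectorFields E U → Γ → Γ) : Prop :=
  ∀ X Y s, curvature D X Y s = 0

namespace FinslerSpacetime

variable (S : FinslerSpacetime E M) {U : Opens M}

/-- The closed cone `Ā` of causal vectors. -/
def causal : Set (TangentBundle 𝓘(ℝ, E) M) := slitClosure S.A

/-- `V` takes values in `Ā`. -/
def IsAdmissible (V : VectorFields E U) : Prop :=
  ∀ p ∈ U, (⟨p, V p⟩ : TangentBundle 𝓘(ℝ, E) M) ∈ S.causal

/-- The metric `g_V` on the tangent space at `p`. -/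
def g (V : VectorFields E U) (p : M) : LinearMap.BilinForm ℝ (TangentSpace 𝓘(ℝ, E) p) :=
  (fundamentalTensor S.L ⟨p, V p⟩).toBilinForm

/-- The Cartan tensor `C_V` on the tangent space at `p`. -/
def C (V : VectorFields E U) (p : M) (x y z : TangentSpace 𝓘(ℝ, E) p) : ℝ :=
  cartanTensor S.L ⟨p, V p⟩ x y z

/-- The characterization of the Levi-Civita–Chern connection `∇^V` of an admissible field `V`:
it is the affine connection on `U` that is torsion-free and almost `g`-compatible. -/
structure IsChernConnection (V : VectorFields E U)
    (D : VectorFields E U → VectorFields E U → VectorFields E U) :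
    Prop where
  linear : IsLinearConnection D
  torsion_free : ∀ X Y, D X Y - D Y X = lieBracket X Y
  almost_compatible : ∀ (X Y Z : VectorFields E U), ∀ p ∈ U,
    mfderiv 𝓘(ℝ, E) 𝓘(ℝ, ℝ) (fun q => S.g V q (Y q) (Z q)) p (X p) =
      S.g V p (D X Y p) (Z p) + S.g V p (Y p) (D X Z p)
        + 2 * S.C V p (D X V p) (Y p) (Z p)

/-- The Levi-Civita–Chern connection `∇^V`: *the* affine connection on `U` that is torsion-free and
almost `g`-compatible with respect to `V`. -/
def chern (V : VectorFields E U) :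
    VectorFields E U → VectorFields E U → VectorFields E U :=
  Classical.epsilon (S.IsChernConnection V)

/-- `N` is the gradient of `f` with respect to `L`: it is admissible and `g_N(N, ·) = df`. -/
def IsGradient (f : SmoothFun E U) (N : VectorFields E U) : Prop :=
  S.IsAdmissible N ∧ ∀ p ∈ U, ∀ x : TangentSpace 𝓘(ℝ, E) p,
    S.g N p (N p) x = mfderiv 𝓘(ℝ, E) 𝓘(ℝ, ℝ) (f : M → ℝ) p x

/-- `N` is lightlike: it takes values in the lightcone (and so vanishes nowhere on `U`). -/
def IsLightlike (N : VectorFields E U) : Prop :=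
  S.IsAdmissible N ∧ ∀ p ∈ U, S.L ⟨p, N p⟩ = 0

/-- `N` is parallel: `∇^N_X N = 0` for all vector fields `X` on `U`. -/
def IsParallel (N : VectorFields E U) : Prop :=
  ∀ X, S.chern N X N = 0

/-- The module `Γ(N^⊥)` of vector fields `X` on `U` with `g_N(N, X) = 0`. -/
def Perp (N : VectorFields E U) :
    Submodule (SmoothFun E U) (VectorFields E U) where
  carrier := {X | ∀ p ∈ U, S.g N p (N p) (X p) = 0}
  add_mem' {X Y} hX hY p hp :=
    (map_add (S.g N p (N p)) (X p) (Y p)).trans (by rw [hX p hp, hY p hp, add_zero])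
  zero_mem' p _ := map_zero (S.g N p (N p))
  smul_mem' f X hX p hp :=
    (map_smul (S.g N p (N p)) (f p) (X p)).trans (by rw [hX p hp, smul_zero])

/-- The module `Γ(N^⊥/N)` of sections of the quotient bundle: classes `[X]` of sections
`X ∈ Γ(N^⊥)`, where `[X] = [X']` means that `X' = X + f N` for a smooth function `f` on `U`. -/
abbrev QuotSections (N : VectorFields E U) :=
  S.Perp N ⧸ (Submodule.span (SmoothFun E U) {N}).submoduleOf (S.Perp N)

/-- The fibre of `N^⊥` at `p`. -/
def PerpFibre (N : VectorFields E U) (p : M) : Submodule ℝ (TangentSpace 𝓘(ℝ, E) p) :=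
  LinearMap.ker (S.g N p (N p))

/-- The fibre of the quotient bundle `N^⊥/N` at `p`. -/
abbrev QuotFibre (N : VectorFields E U) (p : M) :=
  S.PerpFibre N p ⧸ (Submodule.span ℝ {N p}).submoduleOf (S.PerpFibre N p)

/-- `(U, L|_U)` is a Finsler pp-wave with respect to `N`: the field `N` is a lightlike parallel
gradient field on `U`, and the Chern curvature satisfies `R_N(X, Y)Z = 0` for all
`X, Y, Z ∈ Γ(N^⊥)`. (As `N` is parallel, the Chern curvature tensor evaluated at `N` is the curvature
tensor of the affine connection `∇^N`.) -/
def IsPPWave (N : VectorFields E U) : Prop :=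
  (∃ f, S.IsGradient f N) ∧ S.IsLightlike N ∧ S.IsParallel N ∧
    ∀ X ∈ S.Perp N, ∀ Y ∈ S.Perp N, ∀ Z ∈ S.Perp N, curvature (S.chern N) X Y Z = 0

end FinslerSpacetime

end Fields

end FinslerPP

end

/-! Everything takes place on `U`, with the Lorentzian metric g = g_N. A parallel `N` kills the
Cartan term in the almost-compatibility identity, so ∇ = ∇^N is torsion-free and metric for g
(`dirDeriv_metric_of_isParallel`), and its curvature has all the symmetries of a Lorentzian
curvature tensor. Differentiating g(N, Y) = 0 and hN shows that ∇ preserves N^⊥ and the multiples of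
N, so it descends to N^⊥/N. Positivity of the quotient metric is the fact that a vector orthogonal
to a null vector n is either a multiple of n or has negative square
(`HasLorentzSignature.neg_or_mem_span`).

Flatness of the quotient says that R(X, Y)Z is a multiple of N for Z in N^⊥ and arbitrary X, Y. The
comparison with the pp-wave condition (`curvature_mem_span_iff`) rests on the pair symmetry g(R(X,
Y)Z, W) = g(R(Z, W)X, Y). If the quotient is flat and X, Y, Z lie in N^⊥, the right side pairs a
multiple of N with Y, hence is zero for every W. Conversely, for Z, W in N^⊥ the 2-form β(X, Y) =
g(R(Z, W)X, Y) has the hyperplane N^⊥ in its kernel, and an alternating form with this property is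
zero; so R(X, Y)Z is orthogonal to N^⊥, that is, a multiple of N (`mem_span_of_forall_perp`).

Since `chern` is a choice among connections with the defining properties, one such connection must
be exhibited (`exists_isChernConnection`). A Koszul formula with a correction tensor
(`exists_torsionFree_connection`) does this. The correction depends on ∇N, which is circular in
general. For a lightlike gradient field the Levi-Civita connection D₀ of g satisfies D₀_N N = 0, so
the correction does not alter the derivatives of N and D₀N can be used in it. -/

namespace FinslerPP

variable {E : Type*} [NormedAddCommGroup E] [NormedSpace ℝ E]
  {M : Type*} [TopologicalSpace M] [ChartedSpace E M]

/-! ### Smooth functions and vector fields on an open set -/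

namespace SmoothFun

variable {U : Opens M}

@[ext] theorem ext {f h : SmoothFun E U} (H : ∀ p, f p = h p) : f = h := DFunLike.ext _ _ H

@[simp] theorem add_apply (f h : SmoothFun E U) (p : M) : (f + h) p = f p + h p := rfl
@[simp] theorem sub_apply (f h : SmoothFun E U) (p : M) : (f - h) p = f p - h p := rfl
@[simp] theorem mul_apply (f h : SmoothFun E U) (p : M) : (f * h) p = f p * h p := rfl
@[simp] theorem neg_apply (f : SmoothFun E U) (p : M) : (-f) p = -f p := rfl
@[simp] theorem zero_apply (p : M) : (0 : SmoothFun E U) p = 0 := rfl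
@[simp] theorem one_apply (p : M) : (1 : SmoothFun E U) p = 1 := rfl

/-- Evaluation at a point, as a ring homomorphism. -/
def eval (p : M) : SmoothFun E U →+* ℝ where
  toFun f := f p
  map_one' := rfl
  map_mul' _ _ := rfl
  map_zero' := rfl
  map_add' _ _ := rfl

@[simp] theorem eval_apply (p : M) (f : SmoothFun E U) : eval p f = f p := rfl

@[simp] theorem sum_apply {ι : Type*} (s : Finset ι) (f : ι → SmoothFun E U) (p : M) :
    (∑ i ∈ s, f i) p = ∑ i ∈ s, f i p := map_sum (eval p) f s

theorem contMDiffAt (f : SmoothFun E U) {p : M} (hp : p ∈ U) :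
    ContMDiffAt 𝓘(ℝ, E) 𝓘(ℝ, ℝ) ∞ f p :=
  (show ContMDiffOn 𝓘(ℝ, E) 𝓘(ℝ, ℝ) ∞ f U from f.2).contMDiffAt (U.isOpen.mem_nhds hp)

theorem mdifferentiableAt (f : SmoothFun E U) {p : M} (hp : p ∈ U) :
    MDifferentiableAt 𝓘(ℝ, E) 𝓘(ℝ, ℝ) f p :=
  (f.contMDiffAt hp).mdifferentiableAt (by simp)

/-- The smooth function given by a function on `M` that is smooth on `U`. -/
def mk (f : M → ℝ) (hf : ∀ p ∈ U, ContMDiffAt 𝓘(ℝ, E) 𝓘(ℝ, ℝ) ∞ f p) : SmoothFun E U :=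
  ⟨f, fun p hp => (hf p hp).contMDiffWithinAt⟩

@[simp] theorem mk_apply (f : M → ℝ) (hf : ∀ p ∈ U, ContMDiffAt 𝓘(ℝ, E) 𝓘(ℝ, ℝ) ∞ f p) (p : M) :
    mk f hf p = f p := rfl

/-- The constant function `1/2`. -/
noncomputable def half : SmoothFun E U := mk (fun _ => 1 / 2) fun _ _ => contMDiffAt_const

/-- Division by two in the ring of smooth functions, needed for the Koszul formula and for
consequences of antisymmetry. -/
theorem two_mul_half : (2 : SmoothFun E U) * half = 1 := by
  ext p
  have : (2 : SmoothFun E U) p = 2 := map_ofNat (eval (E := E) (U := U) p) 2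
  simp [half, this]

end SmoothFun

variable [IsManifold 𝓘(ℝ, E) ∞ M]

namespace VectorFields

variable {U : Opens M}

@[ext] theorem ext {X Y : VectorFields E U} (H : ∀ p, X p = Y p) : X = Y := DFunLike.ext _ _ H

theorem ext_on {X Y : VectorFields E U} (H : ∀ p ∈ U, X p = Y p) : X = Y := by
  ext p
  by_cases hp : p ∈ U
  · exact H p hp
  · rw [X.eq_zero p hp, Y.eq_zero p hp]

@[simp] theorem add_apply (X Y : VectorFields E U) (p : M) : (X + Y) p = X p + Y p := rfl
@[simp] theorem sub_apply (X Y : VectorFields E U) (p : M) : (X - Y) p = X p - Y p := rfl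
@[simp] theorem neg_apply (X : VectorFields E U) (p : M) : (-X) p = -X p := rfl
@[simp] theorem zero_apply (p : M) : (0 : VectorFields E U) p = 0 := rfl
@[simp] theorem smul_apply (f : SmoothFun E U) (X : VectorFields E U) (p : M) :
    (f • X) p = f p • X p := rfl

/-- Evaluation at a point, as an additive homomorphism. -/
def eval (p : M) : VectorFields E U →+ TangentSpace 𝓘(ℝ, E) p where
  toFun X := X p
  map_zero' := rfl
  map_add' _ _ := rfl

@[simp] theorem sum_apply {ι : Type*} (s : Finset ι) (X : ι → VectorFields E U) (p : M) :
    (∑ i ∈ s, X i) p = ∑ i ∈ s, X i p := map_sum (eval p) X s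

theorem contMDiffAt (X : VectorFields E U) {p : M} (hp : p ∈ U) :
    ContMDiffAt 𝓘(ℝ, E) 𝓘(ℝ, E).tangent ∞
      (fun p => (⟨p, X p⟩ : TangentBundle 𝓘(ℝ, E) M)) p :=
  X.contMDiffOn.contMDiffAt (U.isOpen.mem_nhds hp)

theorem mdifferentiableAt (X : VectorFields E U) {p : M} (hp : p ∈ U) :
    MDifferentiableAt 𝓘(ℝ, E) 𝓘(ℝ, E).tangent
      (fun p => (⟨p, X p⟩ : TangentBundle 𝓘(ℝ, E) M)) p :=
  (X.contMDiffAt hp).mdifferentiableAt (by simp)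

open Classical in
/-- The vector field on `U` given by a section over `M` that is smooth on `U`. -/
noncomputable def mk (X : (p : M) → TangentSpace 𝓘(ℝ, E) p)
    (hX : ∀ p ∈ U, ContMDiffAt 𝓘(ℝ, E) 𝓘(ℝ, E).tangent ∞
      (fun p => (⟨p, X p⟩ : TangentBundle 𝓘(ℝ, E) M)) p) : VectorFields E U :=
  ⟨fun p => if p ∈ U then X p else 0,
    ContMDiffOn.congr (fun p hp => (hX p hp).contMDiffWithinAt) (fun p hp => by
      have hp' : p ∈ U := hp
      simp [hp']), fun p hp => by simp [hp]⟩

theorem mk_apply {X : (p : M) → TangentSpace 𝓘(ℝ, E) p}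
    (hX : ∀ p ∈ U, ContMDiffAt 𝓘(ℝ, E) 𝓘(ℝ, E).tangent ∞
      (fun p => (⟨p, X p⟩ : TangentBundle 𝓘(ℝ, E) M)) p) {p : M} (hp : p ∈ U) :
    mk X hX p = X p := by
  exact if_pos hp

end VectorFields

/-! ### Directional derivatives and Lie brackets -/

section Derivative

variable {U : Opens M}

theorem dirDeriv_apply (X : VectorFields E U) (f : SmoothFun E U) (p : M) :
    dirDeriv X f p = mfderiv 𝓘(ℝ, E) 𝓘(ℝ, ℝ) f p (X p) := rfl

theorem dirDeriv_add_left (X Y : VectorFields E U) (f : SmoothFun E U) :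
    dirDeriv (X + Y) f = dirDeriv X f + dirDeriv Y f := by
  ext p
  exact map_add (mfderiv 𝓘(ℝ, E) 𝓘(ℝ, ℝ) f p) (X p) (Y p)

theorem dirDeriv_smul_left (h : SmoothFun E U) (X : VectorFields E U) (f : SmoothFun E U) :
    dirDeriv (h • X) f = h * dirDeriv X f := by
  ext p
  exact map_smul (mfderiv 𝓘(ℝ, E) 𝓘(ℝ, ℝ) f p) (h p) (X p)

theorem dirDeriv_apply_of_notMem (X : VectorFields E U) (f : SmoothFun E U) {p : M}
    (hp : p ∉ U) : dirDeriv X f p = 0 := by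
  rw [dirDeriv_apply, X.eq_zero p hp]
  exact map_zero _

theorem dirDeriv_add (X : VectorFields E U) (f h : SmoothFun E U) :
    dirDeriv X (f + h) = dirDeriv X f + dirDeriv X h := by
  ext p
  by_cases hp : p ∈ U
  · have := mfderiv_add (f.mdifferentiableAt hp) (h.mdifferentiableAt hp)
    exact congrArg (fun T : TangentSpace 𝓘(ℝ, E) p →L[ℝ] ℝ => T (X p)) this
  · simp [dirDeriv_apply_of_notMem _ _ hp]

theorem dirDeriv_mul (X : VectorFields E U) (f h : SmoothFun E U) :
    dirDeriv X (f * h) = f * dirDeriv X h + dirDeriv X f * h := by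
  ext p
  by_cases hp : p ∈ U
  · have := ((f.mdifferentiableAt hp).hasMFDerivAt.mul
      (h.mdifferentiableAt hp).hasMFDerivAt).mfderiv
    have := congrArg (fun T : TangentSpace 𝓘(ℝ, E) p →L[ℝ] ℝ => T (X p)) this
    refine this.trans ?_
    rw [SmoothFun.add_apply, SmoothFun.mul_apply, SmoothFun.mul_apply, mul_comm (dirDeriv X f p)]
    rfl
  · simp [dirDeriv_apply_of_notMem _ _ hp]

theorem dirDeriv_zero (X : VectorFields E U) : dirDeriv X (0 : SmoothFun E U) = 0 := by
  simpa using dirDeriv_add X 0 0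

theorem dirDeriv_neg (X : VectorFields E U) (f : SmoothFun E U) :
    dirDeriv X (-f) = -dirDeriv X f := by
  have := dirDeriv_add X f (-f)
  rw [add_neg_cancel, dirDeriv_zero] at this
  exact eq_neg_of_add_eq_zero_right this.symm

variable [FiniteDimensional ℝ E]

theorem lieBracket_apply (X Y : VectorFields E U) {p : M} (hp : p ∈ U) :
    lieBracket X Y p = VectorField.mlieBracket 𝓘(ℝ, E) X Y p := by
  exact if_pos hp

theorem lieBracket_swap (X Y : VectorFields E U) : lieBracket X Y = -lieBracket Y X := by
  refine VectorFields.ext_on fun p hp => ?_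
  rw [VectorFields.neg_apply, lieBracket_apply _ _ hp, lieBracket_apply _ _ hp,
    VectorField.mlieBracket_swap_apply]

theorem lieBracket_add_right (X Y Z : VectorFields E U) :
    lieBracket X (Y + Z) = lieBracket X Y + lieBracket X Z := by
  have : CompleteSpace E := FiniteDimensional.complete ℝ E
  have : IsManifold 𝓘(ℝ, E) 2 M :=
    .of_le (n := ∞) (WithTop.coe_le_coe.2 (le_top : (2 : ℕ∞) ≤ ⊤))
  refine VectorFields.ext_on fun p hp => ?_
  rw [VectorFields.add_apply, lieBracket_apply _ _ hp, lieBracket_apply _ _ hp,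
    lieBracket_apply _ _ hp]
  exact VectorField.mlieBracket_add_right (Y.mdifferentiableAt hp) (Z.mdifferentiableAt hp)

theorem lieBracket_smul_right (X : VectorFields E U) (f : SmoothFun E U) (Y : VectorFields E U) :
    lieBracket X (f • Y) = dirDeriv X f • Y + f • lieBracket X Y := by
  have : CompleteSpace E := FiniteDimensional.complete ℝ E
  have : IsManifold 𝓘(ℝ, E) 2 M :=
    .of_le (n := ∞) (WithTop.coe_le_coe.2 (le_top : (2 : ℕ∞) ≤ ⊤))
  refine VectorFields.ext_on fun p hp => ?_
  rw [VectorFields.add_apply, VectorFields.smul_apply, VectorFields.smul_apply,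
    lieBracket_apply _ _ hp, lieBracket_apply _ _ hp]
  exact VectorField.mlieBracket_smul_right (f.mdifferentiableAt hp) (Y.mdifferentiableAt hp)

theorem lieBracket_add_left (X Y Z : VectorFields E U) :
    lieBracket (X + Y) Z = lieBracket X Z + lieBracket Y Z := by
  rw [lieBracket_swap, lieBracket_add_right, lieBracket_swap X, lieBracket_swap Y, neg_add]

theorem lieBracket_smul_left (f : SmoothFun E U) (X Y : VectorFields E U) :
    lieBracket (f • X) Y = -dirDeriv Y f • X + f • lieBracket X Y := by
  rw [lieBracket_swap, lieBracket_smul_right, lieBracket_swap X Y, neg_add, neg_smul, smul_neg]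

/-- The Jacobi identity. -/
theorem lieBracket_leibniz (X Y Z : VectorFields E U) :
    lieBracket X (lieBracket Y Z) =
      lieBracket (lieBracket X Y) Z + lieBracket Y (lieBracket X Z) := by
  have : CompleteSpace E := FiniteDimensional.complete ℝ E
  have hle : minSmoothness ℝ 2 ≤ ((⊤ : ℕ∞) : WithTop ℕ∞) := by
    rw [minSmoothness_of_isRCLikeNormedField]
    exact WithTop.coe_le_coe.2 (le_top : (2 : ℕ∞) ≤ ⊤)
  have : IsManifold 𝓘(ℝ, E) (minSmoothness ℝ 3) M := .of_le (n := ∞) (by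
    rw [minSmoothness_of_isRCLikeNormedField]
    exact WithTop.coe_le_coe.2 (le_top : (3 : ℕ∞) ≤ ⊤))
  refine VectorFields.ext_on fun p hp => ?_
  have hcongr : ∀ A B : VectorFields E U,
      (lieBracket A B : (p : M) → TangentSpace 𝓘(ℝ, E) p) =ᶠ[𝓝 p]
        VectorField.mlieBracket 𝓘(ℝ, E) A B := fun A B => by
    filter_upwards [U.isOpen.mem_nhds hp] with q hq using lieBracket_apply A B hq
  have h1 := Filter.EventuallyEq.mlieBracket_vectorField_eq (I := 𝓘(ℝ, E))
    (Filter.EventuallyEq.refl _ (X : (p : M) → TangentSpace 𝓘(ℝ, E) p)) (hcongr Y Z)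
  have h2 := Filter.EventuallyEq.mlieBracket_vectorField_eq (I := 𝓘(ℝ, E)) (hcongr X Y)
    (Filter.EventuallyEq.refl _ (Z : (p : M) → TangentSpace 𝓘(ℝ, E) p))
  have h3 := Filter.EventuallyEq.mlieBracket_vectorField_eq (I := 𝓘(ℝ, E))
    (Filter.EventuallyEq.refl _ (Y : (p : M) → TangentSpace 𝓘(ℝ, E) p)) (hcongr X Z)
  rw [VectorFields.add_apply, lieBracket_apply _ _ hp, lieBracket_apply _ _ hp,
    lieBracket_apply _ _ hp, h1, h2, h3]
  exact VectorField.leibniz_identity_mlieBracket_apply ((X.contMDiffAt hp).of_le hle)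
    ((Y.contMDiffAt hp).of_le hle) ((Z.contMDiffAt hp).of_le hle)

end Derivative

/-! ### Local frames, tensoriality, and inversion of nondegenerate forms -/

section Tensoriality

variable {E : Type*} [NormedAddCommGroup E] [NormedSpace ℝ E]
  {M : Type*} [TopologicalSpace M] [ChartedSpace E M] [IsManifold 𝓘(ℝ, E) ∞ M]
  {U : Opens M}

/-- The indicator of `U` counts as a smooth function on `U` and fixes every vector field, since
fields are extended by zero. Linearity then makes the value of the functional vanish off `U`, so
identities between functionals need checking only on `U`. -/
theorem linearMap_apply_of_notMem
    (α : VectorFields E U →ₗ[SmoothFun E U] SmoothFun E U) {p : M} (hp : p ∉ U)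
    (X : VectorFields E U) : α X p = 0 := by
  classical
  let χ : SmoothFun E U := .mk (fun q => if q ∈ U then 1 else 0) fun q hq =>
    (contMDiffAt_const (c := (1 : ℝ))).congr_of_eventuallyEq (by
      filter_upwards [U.isOpen.mem_nhds hq] with r hr using if_pos hr)
  have h0 : χ • X = X := VectorFields.ext_on fun q hq => by simp [χ, hq]
  have := congrArg (fun f : SmoothFun E U => f p) (congrArg α h0)
  simpa [χ, hp] using this.symm

variable [FiniteDimensional ℝ E] [T2Space M]

/-- There is a smooth function that is one near `p` and zero outside of a given neighbourhood of
`p`. -/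
theorem exists_smoothFun_bump {p : M} {s : Set M} (hs : s ∈ 𝓝 p) :
    ∃ χ : SmoothFun E U, (∀ᶠ q in 𝓝 p, χ q = 1) ∧ ∀ q ∉ s, χ q = 0 := by
  obtain ⟨χ, -, hχ⟩ := (SmoothBumpFunction.nhds_basis_tsupport (I := 𝓘(ℝ, E)) p).mem_iff.1 hs
  refine ⟨.mk χ fun q _ => χ.contMDiffAt, χ.eventuallyEq_one, fun q hq => ?_⟩
  exact image_eq_zero_of_notMem_tsupport fun h => hq (hχ h)

/-- A section that is smooth near `p` agrees near `p` with a vector field on `U`. -/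
theorem exists_vectorFields_eventuallyEq {p : M} (hp : p ∈ U) {W : Set M} (hW : IsOpen W)
    (hpW : p ∈ W) {s : (q : M) → TangentSpace 𝓘(ℝ, E) q}
    (hs : ContMDiffOn 𝓘(ℝ, E) 𝓘(ℝ, E).tangent ∞
      (fun q => (⟨q, s q⟩ : TangentBundle 𝓘(ℝ, E) M)) W) :
    ∃ X : VectorFields E U, ∀ᶠ q in 𝓝 p, X q = s q := by
  obtain ⟨χ, -, hχ⟩ := (SmoothBumpFunction.nhds_basis_tsupport (I := 𝓘(ℝ, E)) p).mem_iff.1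
    (hW.mem_nhds hpW)
  have h := ContMDiffOn.smul_section_of_tsupport (s := s) (n := ∞) χ.contMDiff.contMDiffOn hW hχ hs
  refine ⟨.mk (fun q => χ q • s q) fun q _ => h.contMDiffAt, ?_⟩
  filter_upwards [χ.eventuallyEq_one, U.isOpen.mem_nhds hp] with q hq hqU
  rw [VectorFields.mk_apply _ hqU, hq]
  exact one_smul ℝ (s q)

/-- A function that is smooth near `p` agrees near `p` with a smooth function on `U`. -/
theorem exists_smoothFun_eventuallyEq {p : M} {W : Set M} (hW : IsOpen W)
    (hpW : p ∈ W) {s : M → ℝ} (hs : ContMDiffOn 𝓘(ℝ, E) 𝓘(ℝ, ℝ) ∞ s W) :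
    ∃ f : SmoothFun E U, ∀ᶠ q in 𝓝 p, f q = s q := by
  obtain ⟨χ, -, hχ⟩ := (SmoothBumpFunction.nhds_basis_tsupport (I := 𝓘(ℝ, E)) p).mem_iff.1
    (hW.mem_nhds hpW)
  have h : ContMDiff 𝓘(ℝ, E) 𝓘(ℝ, ℝ) ∞ (fun q => χ q • s q) := by
    refine contMDiff_of_tsupport fun q hq => ?_
    have hqW : q ∈ W := hχ (tsupport_smul_subset_left _ _ hq)
    exact χ.contMDiffAt.smul (hs.contMDiffAt (hW.mem_nhds hqW))
  refine ⟨.mk _ fun q _ => h.contMDiffAt, ?_⟩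
  filter_upwards [χ.eventuallyEq_one] with q hq
  simp [hq]

/-- Around each point of `U` there is a frame consisting of vector fields on `U`, with smooth
coefficients. -/
theorem exists_frame {p : M} (hp : p ∈ U) :
    ∃ e : Fin (Module.finrank ℝ E) → VectorFields E U,
      (∀ᶠ q in 𝓝 p, LinearIndependent ℝ (fun i => e i q)) ∧
      ∀ X : VectorFields E U, ∃ c : Fin (Module.finrank ℝ E) → SmoothFun E U,
        ∀ᶠ q in 𝓝 p, X q = ∑ i, c i q • e i q := by
  let b := Module.finBasis ℝ E
  let t := trivializationAt E (TangentSpace 𝓘(ℝ, E) : M → Type _) p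
  have hpt : p ∈ t.baseSet := mem_baseSet_trivializationAt E _ p
  have : IsManifold 𝓘(ℝ, E) (((⊤ : ℕ∞) : WithTop ℕ∞) + 1) M := by simpa
  have : ContMDiffVectorBundle ∞ E (TangentSpace 𝓘(ℝ, E) : M → Type _) 𝓘(ℝ, E) := inferInstance
  have : ContMDiffVectorBundle 1 E (TangentSpace 𝓘(ℝ, E) : M → Type _) 𝓘(ℝ, E) := .of_le (n := ∞)
    (WithTop.coe_le_coe.2 (le_top : (1 : ℕ∞) ≤ ⊤))
  have hex : ∀ i, ∃ X : VectorFields E U, ∀ᶠ q in 𝓝 p, X q = t.localFrame b i q := fun i =>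
    exists_vectorFields_eventuallyEq hp t.open_baseSet hpt
      (t.contMDiffOn_localFrame_baseSet (I := 𝓘(ℝ, E)) ∞ b i)
  choose e he using hex
  have hee : ∀ᶠ q in 𝓝 p, ∀ i, e i q = t.localFrame b i q := Filter.eventually_all.2 he
  refine ⟨e, ?_, fun X => ?_⟩
  · filter_upwards [hee, t.open_baseSet.mem_nhds hpt] with q hq hqt
    have := (t.isLocalFrameOn_localFrame_baseSet 𝓘(ℝ, E) ∞ b).linearIndependent hqt
    simpa only [hq] using this
  · have hex : ∀ i, ∃ c : SmoothFun E U, ∀ᶠ q in 𝓝 p, c q =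
        t.localFrameCoeff 𝓘(ℝ, E) b i q (X q) := fun i => by
      refine exists_smoothFun_eventuallyEq (t.open_baseSet.inter U.isOpen) ⟨hpt, hp⟩ ?_
      intro q hq
      exact (contMDiffAt_localFrameCoeff b hq.1 (X.contMDiffAt hq.2) i).contMDiffWithinAt
    choose c hc using hex
    refine ⟨c, ?_⟩
    filter_upwards [hee, Filter.eventually_all.2 hc, t.open_baseSet.mem_nhds hpt] with q hq hcq hqt
    simp only [hq, hcq]
    exact t.eq_sum_localFrameCoeff_smul (I := 𝓘(ℝ, E)) (s := X) hqt

theorem exists_vectorFields_apply_eq {p : M} (hp : p ∈ U) (v : TangentSpace 𝓘(ℝ, E) p) :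
    ∃ X : VectorFields E U, X p = v := by
  obtain ⟨e, he, -⟩ := exists_frame (E := E) hp
  have : FiniteDimensional ℝ (TangentSpace 𝓘(ℝ, E) p) := inferInstanceAs (FiniteDimensional ℝ E)
  have hspan : Submodule.span ℝ (Set.range fun i => e i p) = ⊤ :=
    he.self_of_nhds.span_eq_top_of_card_eq_finrank' (by
      rw [Fintype.card_fin]; rfl)
  have hv : v ∈ Submodule.span ℝ (Set.range fun i => e i p) := hspan ▸ Submodule.mem_top
  obtain ⟨c, hc⟩ := (Submodule.mem_span_range_iff_exists_fun ℝ).1 hv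
  refine ⟨∑ i, (SmoothFun.mk (fun _ => c i) fun _ _ => contMDiffAt_const : SmoothFun E U) • e i, ?_⟩
  simpa using hc

section Functional

variable (α : VectorFields E U →ₗ[SmoothFun E U] SmoothFun E U)

/-- Locality: a bump function supported where the two fields agree makes them equal without changing
the value at `p`. -/
theorem linearMap_apply_congr_eventually {p : M} {X Y : VectorFields E U}
    (h : ∀ᶠ q in 𝓝 p, X q = Y q) : α X p = α Y p := by
  obtain ⟨χ, hχ, hχ0⟩ := exists_smoothFun_bump (E := E) (U := U) h
  have h0 : χ • X = χ • Y := by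
    ext q
    by_cases hq : X q = Y q
    · simp [hq]
    · simp [hχ0 q hq]
  have := congrArg (fun f : SmoothFun E U => f p) (congrArg α h0)
  simpa [hχ.self_of_nhds] using this

/-- A functional that is linear over the smooth functions acts pointwise. -/
theorem linearMap_apply_eq_zero {p : M} (hp : p ∈ U) {X : VectorFields E U} (h : X p = 0) :
    α X p = 0 := by
  obtain ⟨e, he, hc⟩ := exists_frame (E := E) hp
  obtain ⟨c, hc⟩ := hc X
  have h1 : α X p = α (∑ i, c i • e i) p :=
    linearMap_apply_congr_eventually α (by simpa using hc)
  have h2 := Fintype.linearIndependent_iff.1 he.self_of_nhds (fun i => c i p)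
    (hc.self_of_nhds.symm.trans h)
  rw [h1]
  simp [h2]

theorem linearMap_apply_congr {p : M} (hp : p ∈ U) {X Y : VectorFields E U} (h : X p = Y p) :
    α X p = α Y p := by
  have := linearMap_apply_eq_zero α hp (X := X - Y) (by simp [h])
  rw [map_sub] at this
  exact sub_eq_zero.1 this

variable {α} in
theorem linearMap_apply_eq_zero_of_frame {p : M} (hp : p ∈ U) {ι : Type*} [Fintype ι]
    {e : ι → VectorFields E U} (hι : Fintype.card ι = Module.finrank ℝ E)
    (he : LinearIndependent ℝ fun i => e i p) (h : ∀ i, α (e i) p = 0) (X : VectorFields E U) :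
    α X p = 0 := by
  have : FiniteDimensional ℝ (TangentSpace 𝓘(ℝ, E) p) := inferInstanceAs (FiniteDimensional ℝ E)
  have hspan : Submodule.span ℝ (Set.range fun i => e i p) = ⊤ :=
    he.span_eq_top_of_card_eq_finrank' hι
  have hv : X p ∈ Submodule.span ℝ (Set.range fun i => e i p) := hspan ▸ Submodule.mem_top
  obtain ⟨c, hc⟩ := (Submodule.mem_span_range_iff_exists_fun ℝ).1 hv
  rw [linearMap_apply_congr α hp (Y := ∑ i,
    (SmoothFun.mk (fun _ => c i) fun _ _ => contMDiffAt_const : SmoothFun E U) • e i)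
    (by simpa using hc.symm)]
  simp [h]

end Functional

/-- A nondegenerate bilinear form identifies functionals on vector fields with vector fields. -/
theorem exists_representing_field
    (B : VectorFields E U →ₗ[SmoothFun E U] VectorFields E U →ₗ[SmoothFun E U] SmoothFun E U)
    (hB : ∀ p ∈ U, ∀ X, (∀ Z, B X Z p = 0) → X p = 0)
    (α : VectorFields E U →ₗ[SmoothFun E U] SmoothFun E U) :
    ∃ W : VectorFields E U, B W = α := by
  -- the solution near `p`, up to the Gram determinant `d`
  have hloc : ∀ p ∈ U, ∃ (W : VectorFields E U) (d : SmoothFun E U),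
      ∀ᶠ q in 𝓝 p, d q ≠ 0 ∧ ∀ Z, B W Z q = d q * α Z q := by
    intro p hp
    obtain ⟨e, he, -⟩ := exists_frame (E := E) hp
    let G : Matrix (Fin (Module.finrank ℝ E)) (Fin (Module.finrank ℝ E)) (SmoothFun E U) :=
      .of fun i j => B (e i) (e j)
    -- Cramer's rule without denominators: the adjugate solves the linear system up to the factor
    -- `G.det`.
    let c := Matrix.vecMul (fun j => α (e j)) G.adjugate
    have hc : Matrix.vecMul c G = fun j => G.det * α (e j) := by
      rw [Matrix.vecMul_vecMul, Matrix.adjugate_mul, Matrix.vecMul_smul, Matrix.vecMul_one]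
      rfl
    have hW : ∀ j, B (∑ i, c i • e i) (e j) = G.det * α (e j) := fun j => by
      rw [← congrFun hc j]
      simp [Matrix.vecMul, dotProduct, G]
    -- A kernel vector of the Gram matrix at `p`, used as constant coefficients in the frame, would
    -- give a field violating nondegeneracy at `p`.
    have hd : G.det p ≠ 0 := by
      intro h0
      have h1 : (G.map (SmoothFun.eval p)).det = 0 := by
        rw [← h0, ← SmoothFun.eval_apply p G.det, RingHom.map_det]
        rfl
      obtain ⟨a, ha, haG⟩ := Matrix.exists_vecMul_eq_zero_iff.2 h1
      let X : VectorFields E U := ∑ i,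
        (SmoothFun.mk (fun _ => a i) fun _ _ => contMDiffAt_const : SmoothFun E U) • e i
      have hX : X p = 0 := hB p hp X fun Z =>
        linearMap_apply_eq_zero_of_frame hp (Fintype.card_fin _) he.self_of_nhds (fun j => by
          have := congrFun haG j
          simpa [Matrix.vecMul, dotProduct, G, X] using this) Z
      refine ha (funext fun i => Fintype.linearIndependent_iff.1 he.self_of_nhds a ?_ i)
      simpa [X] using hX
    have hdc : ∀ᶠ q in 𝓝 p, G.det q ≠ 0 :=
      (G.det.contMDiffAt hp).continuousAt.eventually_ne hd
    refine ⟨∑ i, c i • e i, G.det, ?_⟩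
    filter_upwards [he, hdc, U.isOpen.mem_nhds hp] with q hq hdq hqU
    refine ⟨hdq, fun Z => ?_⟩
    have := linearMap_apply_eq_zero_of_frame (α := B (∑ i, c i • e i) - G.det • α) hqU
      (Fintype.card_fin _) hq (fun j => by
        rw [LinearMap.sub_apply, LinearMap.smul_apply, hW, smul_eq_mul, sub_self]
        rfl) Z
    exact sub_eq_zero.1 this
  choose! W d hWd using hloc
  -- By nondegeneracy the local solutions agree after division by their determinants. The pointwise
  -- choice on the diagonal is thus locally one smooth solution, and no partition of unity is
  -- needed.
  have huniq : ∀ p ∈ U, ∀ᶠ q in 𝓝 p, (d q q)⁻¹ • W q q = (d p q)⁻¹ • W p q := by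
    intro p hp
    filter_upwards [hWd p hp, U.isOpen.mem_nhds hp] with q hq hqU
    have hq' := (hWd q hqU).self_of_nhds
    have := hB q hqU (d p • W q - d q • W p) fun Z => by
      have h1 := hq.2 Z
      have h2 := hq'.2 Z
      simp only [map_sub, map_smul, LinearMap.sub_apply, LinearMap.smul_apply, smul_eq_mul,
        SmoothFun.sub_apply, SmoothFun.mul_apply, h1, h2]
      ring
    rw [VectorFields.sub_apply, VectorFields.smul_apply, VectorFields.smul_apply,
      sub_eq_zero] at this
    rw [inv_smul_eq_iff₀ hq'.1, smul_comm, ← this, inv_smul_smul₀ hq.1]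
  have hsm : ∀ p ∈ U, ContMDiffAt 𝓘(ℝ, E) 𝓘(ℝ, E).tangent ∞
      (fun q => (⟨q, (d q q)⁻¹ • W q q⟩ : TangentBundle 𝓘(ℝ, E) M)) p := by
    intro p hp
    have h1 : ContMDiffAt 𝓘(ℝ, E) 𝓘(ℝ, ℝ) ∞ (fun q => (d p q)⁻¹) p :=
      ((d p).contMDiffAt hp).inv₀ (hWd p hp).self_of_nhds.1
    have h2 := ContMDiffAt.smul_section h1 ((W p).contMDiffAt hp)
    refine h2.congr_of_eventuallyEq ?_
    filter_upwards [huniq p hp] with q hq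
    rw [hq]
    rfl
  refine ⟨.mk _ hsm, LinearMap.ext fun Z => SmoothFun.ext fun p => ?_⟩
  by_cases hp : p ∈ U
  swap
  · rw [linearMap_apply_of_notMem _ hp, linearMap_apply_of_notMem _ hp]
  have hp' := (hWd p hp).self_of_nhds
  have h1 : B (d p • VectorFields.mk _ hsm) Z p = B (W p) Z p := by
    have := linearMap_apply_congr (B.flip Z) hp (X := d p • VectorFields.mk _ hsm) (Y := W p) (by
      rw [VectorFields.smul_apply, VectorFields.mk_apply _ hp, smul_inv_smul₀ hp'.1])
    exact this
  rw [map_smul, LinearMap.smul_apply, smul_eq_mul, SmoothFun.mul_apply, hp'.2] at h1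
  exact mul_left_cancel₀ hp'.1 h1

end Tensoriality

/-! ### Iterated derivatives under linear isomorphisms and for homogeneous functions -/

section Calculus

variable {E : Type*} [NormedAddCommGroup E] [NormedSpace ℝ E]
  {F : Type*} [NormedAddCommGroup F] [NormedSpace ℝ F]
  {H : Type*} [NormedAddCommGroup H] [NormedSpace ℝ H]

theorem fderiv_comp_equiv_apply (f : F → H) (A : E ≃L[ℝ] F) (y u : E) :
    fderiv ℝ (fun z => f (A z)) y u = fderiv ℝ f (A y) (A u) := by
  have := A.comp_right_fderiv (f := f) (x := y)
  exact congrArg (fun T => T u) this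

theorem fderiv_fderiv_comp_equiv_apply {f : F → H} (A : E ≃L[ℝ] F) {y : E}
    (hf : ContDiffAt ℝ 2 f (A y)) (u w : E) :
    fderiv ℝ (fderiv ℝ fun z => f (A z)) y u w = fderiv ℝ (fderiv ℝ f) (A y) (A u) (A w) := by
  have h1 : (fderiv ℝ fun z => f (A z)) = fun z => (fderiv ℝ f (A z)).comp (A : E →L[ℝ] F) :=
    funext fun z => A.comp_right_fderiv
  have h2 : DifferentiableAt ℝ (fderiv ℝ f) (A y) :=
    (hf.fderiv_right (m := 1) le_rfl).differentiableAt one_ne_zero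
  have h3 : DifferentiableAt ℝ (fun z => fderiv ℝ f (A z)) y :=
    h2.comp y A.differentiableAt
  rw [h1, fderiv_clm_comp h3 (by fun_prop)]
  simp [fderiv_comp_equiv_apply (fderiv ℝ f) A]

theorem fderiv_fderiv_fderiv_comp_equiv_apply {f : F → H} (A : E ≃L[ℝ] F) {y : E}
    (hf : ContDiffAt ℝ 3 f (A y)) (u w z : E) :
    fderiv ℝ (fderiv ℝ (fderiv ℝ fun z => f (A z))) y u w z =
      fderiv ℝ (fderiv ℝ (fderiv ℝ f)) (A y) (A u) (A w) (A z) := by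
  have h1 : (fderiv ℝ fun z => f (A z)) = fun z => (fderiv ℝ f (A z)).comp (A : E →L[ℝ] F) :=
    funext fun z => A.comp_right_fderiv
  have h2 : ContDiffAt ℝ 2 (fderiv ℝ f) (A y) := hf.fderiv_right (m := 2) le_rfl
  let Ψ : (F →L[ℝ] H) →L[ℝ] (E →L[ℝ] H) := ContinuousLinearMap.precomp H (A : E →L[ℝ] F)
  have h3 : fderiv ℝ (fderiv ℝ fun z => f (A z)) =ᶠ[𝓝 y]
      fun z => Ψ.comp (fderiv ℝ (fun z => fderiv ℝ f (A z)) z) := by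
    have hev : ∀ᶠ z in 𝓝 y, ContDiffAt ℝ 2 (fderiv ℝ f) (A z) :=
      A.continuous.continuousAt.eventually (h2.eventually (by simp))
    filter_upwards [hev] with z hz
    rw [h1]
    have hd : DifferentiableAt ℝ (fun z => fderiv ℝ f (A z)) z :=
      (hz.differentiableAt two_ne_zero).comp z A.differentiableAt
    exact ((Ψ.hasFDerivAt).comp z hd.hasFDerivAt).fderiv
  rw [h3.fderiv_eq]
  have hd : DifferentiableAt ℝ (fderiv ℝ fun z => fderiv ℝ f (A z)) y := by
    have : ContDiffAt ℝ 2 (fun z => fderiv ℝ f (A z)) y :=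
      h2.comp y A.contDiff.contDiffAt
    exact (this.fderiv_right (m := 1) le_rfl).differentiableAt one_ne_zero
  rw [fderiv_clm_comp (by fun_prop) hd]
  simp [fderiv_fderiv_comp_equiv_apply A h2, Ψ]

theorem two_le_smooth : minSmoothness ℝ 2 ≤ ∞ := by
  rw [minSmoothness_of_isRCLikeNormedField]
  exact WithTop.coe_le_coe.2 (le_top : (2 : ℕ∞) ≤ ⊤)

/-- Euler's relation for a function that is positively homogeneous of degree two. -/
theorem fderiv_self_of_homogeneous {f : E → ℝ} {y : E} (hf : DifferentiableAt ℝ f y)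
    (hom : ∀ c : ℝ, 0 < c → f (c • y) = c ^ 2 * f y) : fderiv ℝ f y y = 2 * f y := by
  have h1 : HasDerivAt (fun c : ℝ => f (c • y)) (fderiv ℝ f y y) 1 := by
    have hf' : HasFDerivAt f (fderiv ℝ f y) ((1 : ℝ) • y) := by
      rw [one_smul]; exact hf.hasFDerivAt
    have := hf'.comp_hasDerivAt (1 : ℝ) ((hasDerivAt_id (1 : ℝ)).smul_const y)
    rw [one_smul] at this
    exact this
  have h2 : HasDerivAt (fun c : ℝ => f (c • y)) (2 * f y) 1 := by
    have : HasDerivAt (fun c : ℝ => c ^ 2 * f y) (2 * f y) 1 := by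
      simpa using (hasDerivAt_pow 2 (1 : ℝ)).mul_const (f y)
    refine this.congr_of_eventuallyEq ?_
    filter_upwards [lt_mem_nhds (zero_lt_one (α := ℝ))] with c hc using hom c hc
  exact h1.unique h2

/-- Differentiate Euler's relation f'(z)z = 2f(z) in the direction `h`. -/
theorem fderiv_fderiv_apply_self_of_homogeneous {f : E → ℝ} {O : Set E}
    (hO : IsOpen O) (hf : ∀ y ∈ O, ContDiffAt ℝ ∞ f y)
    (hom : ∀ y ∈ O, ∀ c : ℝ, 0 < c → f (c • y) = c ^ 2 * f y) {y : E} (hy : y ∈ O) (h : E) :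
    fderiv ℝ (fderiv ℝ f) y h y = fderiv ℝ f y h := by
  have h1 : (fun z => fderiv ℝ f z z) =ᶠ[𝓝 y] fun z => 2 * f z := by
    filter_upwards [hO.mem_nhds hy] with z hz
    exact fderiv_self_of_homogeneous ((hf z hz).differentiableAt (by simp)) (hom z hz)
  have h2 := congrArg (fun T : E →L[ℝ] ℝ => T h) h1.fderiv_eq
  have hd : DifferentiableAt ℝ (fderiv ℝ f) y :=
    ((hf y hy).fderiv_right (m := 1) (by exact WithTop.coe_le_coe.2 le_top)).differentiableAt
      one_ne_zero
  rw [fderiv_clm_apply hd differentiableAt_fun_id,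
    fderiv_const_mul ((hf y hy).differentiableAt (by simp))] at h2
  simp at h2
  linarith

/-- Differentiate f''(z)(h, z) = f'(z)h once more, in the direction `k`; the two second-order terms
cancel by symmetry. -/
theorem fderiv_fderiv_fderiv_apply_self_of_homogeneous {f : E → ℝ} {O : Set E}
    (hO : IsOpen O) (hf : ∀ y ∈ O, ContDiffAt ℝ ∞ f y)
    (hom : ∀ y ∈ O, ∀ c : ℝ, 0 < c → f (c • y) = c ^ 2 * f y) {y : E} (hy : y ∈ O) (k h : E) :
    fderiv ℝ (fderiv ℝ (fderiv ℝ f)) y k h y = 0 := by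
  have h1 : (fun z => fderiv ℝ (fderiv ℝ f) z h z) =ᶠ[𝓝 y] fun z => fderiv ℝ f z h := by
    filter_upwards [hO.mem_nhds hy] with z hz
    exact fderiv_fderiv_apply_self_of_homogeneous hO hf hom hz h
  have h2 := congrArg (fun T : E →L[ℝ] ℝ => T k) h1.fderiv_eq
  have hc : ContDiffAt ℝ 2 (fderiv ℝ f) y :=
    (hf y hy).fderiv_right (m := 2) (by exact WithTop.coe_le_coe.2 le_top)
  have hd : DifferentiableAt ℝ (fderiv ℝ f) y := hc.differentiableAt two_ne_zero
  have hd2 : DifferentiableAt ℝ (fderiv ℝ (fderiv ℝ f)) y :=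
    (hc.fderiv_right (m := 1) le_rfl).differentiableAt one_ne_zero
  have hd3 : DifferentiableAt ℝ (fun z => fderiv ℝ (fderiv ℝ f) z h) y :=
    hd2.clm_apply (differentiableAt_const h)
  rw [fderiv_clm_apply hd3 differentiableAt_fun_id,
    fderiv_clm_apply hd2 (differentiableAt_const h),
    fderiv_clm_apply hd (differentiableAt_const h)] at h2
  have hsymm : fderiv ℝ (fderiv ℝ f) y h k = fderiv ℝ (fderiv ℝ f) y k h :=
    ((hf y hy).isSymmSndFDerivAt two_le_smooth).eq h k
  simp at h2
  linarith

/-- The second derivative is symmetric on a whole neighbourhood of `y`, so the symmetry may be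
differentiated. -/
theorem fderiv_fderiv_fderiv_swap_right {f : E → ℝ} {y : E} (hf : ContDiffAt ℝ ∞ f y)
    (a b c : E) :
    fderiv ℝ (fderiv ℝ (fderiv ℝ f)) y a b c = fderiv ℝ (fderiv ℝ (fderiv ℝ f)) y a c b := by
  have hc : ContDiffAt ℝ ∞ (fderiv ℝ f) y := hf.fderiv_right (m := ∞) (by simp)
  have hc2 : DifferentiableAt ℝ (fderiv ℝ (fderiv ℝ f)) y :=
    (hc.fderiv_right (m := ∞) (by simp)).differentiableAt (by simp)
  have h1 : (fun z => fderiv ℝ (fderiv ℝ f) z b c) =ᶠ[𝓝 y]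
      fun z => fderiv ℝ (fderiv ℝ f) z c b := by
    filter_upwards [(hf.of_le (m := 2) (WithTop.coe_le_coe.2 le_top)).eventually (by simp)]
      with z hz
    exact (hz.isSymmSndFDerivAt (by simp)).eq b c
  have h2 : ∀ u w : E, fderiv ℝ (fun z => fderiv ℝ (fderiv ℝ f) z u w) y a =
      fderiv ℝ (fderiv ℝ (fderiv ℝ f)) y a u w := fun u w => by
    rw [fderiv_clm_apply (hc2.clm_apply (differentiableAt_const u)) (differentiableAt_const w),
      fderiv_clm_apply hc2 (differentiableAt_const u)]
    simp
  rw [← h2 b c, ← h2 c b, h1.fderiv_eq]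

/-- The partial derivatives in the second variable of a smooth function are smooth. -/
theorem contDiffAt_fderiv_snd {f : E → F → H} {x : E × F}
    (hf : ContDiffAt ℝ ∞ (fun x : E × F => f x.1 x.2) x) :
    ContDiffAt ℝ ∞ (fun x : E × F => fderiv ℝ (f x.1) x.2) x := by
  refine ContDiffAt.fderiv (n := ∞) (f := fun x : E × F => f x.1) (g := Prod.snd) ?_ contDiffAt_snd
    (by simp)
  exact ContDiffAt.comp (g := fun x : E × F => f x.1 x.2) (f := fun w : (E × F) × F => (w.1.1, w.2))
    (x, x.2) hf (by fun_prop)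

end Calculus

/-! ### Smoothness of the fundamental and Cartan tensors in bundle charts -/

section Coordinates

variable {E : Type*} [NormedAddCommGroup E] [NormedSpace ℝ E]
  {M : Type*} [TopologicalSpace M] [ChartedSpace E M] [IsManifold 𝓘(ℝ, E) ∞ M]

/-- The function `L` on the tangent bundle in the coordinates around `p₀`. -/
noncomputable def localRep (L : TangentBundle 𝓘(ℝ, E) M → ℝ) (p₀ : M) (x z : E) : ℝ :=
  L ((trivializationAt E (TangentSpace 𝓘(ℝ, E) : M → Type _) p₀).toOpenPartialHomeomorph.symm
    ((extChartAt 𝓘(ℝ, E) p₀).symm x, z))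

/-- The fibre coordinates of a tangent vector in the chart around `p₀`. -/
noncomputable def fibreCoord (p₀ : M) (v : TangentBundle 𝓘(ℝ, E) M) : E :=
  (trivializationAt E (TangentSpace 𝓘(ℝ, E) : M → Type _) p₀ v).2

/-- The fibre coordinates on a single tangent space, as a linear isomorphism. -/
noncomputable def fibreCoordEquiv (p₀ q : M) (hq : q ∈ (chartAt E p₀).source) : E ≃L[ℝ] E :=
  (trivializationAt E (TangentSpace 𝓘(ℝ, E) : M → Type _) p₀).continuousLinearEquivAt ℝ q hq

theorem apply_eq_localRep (L : TangentBundle 𝓘(ℝ, E) M → ℝ) {p₀ q : M}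
    (hq : q ∈ (chartAt E p₀).source) (y : TangentSpace 𝓘(ℝ, E) q) :
    L ⟨q, y⟩ = localRep L p₀ (extChartAt 𝓘(ℝ, E) p₀ q) (fibreCoord p₀ ⟨q, y⟩) := by
  have hq' : q ∈ (extChartAt 𝓘(ℝ, E) p₀).source := by rwa [extChartAt_source]
  let t := trivializationAt E (TangentSpace 𝓘(ℝ, E) : M → Type _) p₀
  have hv : (⟨q, y⟩ : TangentBundle 𝓘(ℝ, E) M) ∈ t.source := t.mem_source.2 hq
  have h1 : t ⟨q, y⟩ = (q, (t ⟨q, y⟩).2) := Prod.ext (t.coe_fst hv) rfl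
  rw [localRep, fibreCoord, (extChartAt 𝓘(ℝ, E) p₀).left_inv hq', ← h1]
  exact congrArg L (t.toOpenPartialHomeomorph.left_inv hv).symm

theorem contDiffAt_localRep {L : TangentBundle 𝓘(ℝ, E) M → ℝ} {v : TangentBundle 𝓘(ℝ, E) M}
    (hL : ContMDiffAt 𝓘(ℝ, E).tangent 𝓘(ℝ, ℝ) ∞ L v) :
    ContDiffAt ℝ ∞ (fun x : E × E => localRep L v.1 x.1 x.2)
      (extChartAt 𝓘(ℝ, E) v.1 v.1, fibreCoord v.1 v) := by
  have h1 := (contMDiffAt_iff.1 hL).2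
  have hr : range 𝓘(ℝ, E).tangent = univ :=
    ModelWithCorners.range_eq_univ _
  rw [hr, contDiffWithinAt_univ] at h1
  rw [FiberBundle.extChartAt] at h1
  have ht : v ∈ (trivializationAt E (TangentSpace 𝓘(ℝ, E) : M → Type _) v.1).source :=
    FiberBundle.mem_trivializationAt_proj_source
  have h2 : trivializationAt E (TangentSpace 𝓘(ℝ, E) : M → Type _) v.1 v =
    (v.1, fibreCoord v.1 v) := Prod.ext (Trivialization.coe_fst _ ht) rfl
  have h3 : (((trivializationAt E (TangentSpace 𝓘(ℝ, E) : M → Type _) v.proj).toPartialEquiv ≫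
      (extChartAt 𝓘(ℝ, E) v.proj).prod (PartialEquiv.refl E)) v) =
      (extChartAt 𝓘(ℝ, E) v.1 v.1, fibreCoord v.1 v) := by
    change ((extChartAt 𝓘(ℝ, E) v.proj).prod (PartialEquiv.refl E))
      (trivializationAt E (TangentSpace 𝓘(ℝ, E) : M → Type _) v.1 v) = _
    rw [h2]
    rfl
  rw [h3] at h1
  exact h1

theorem contDiffAt_fderiv_fderiv_localRep {L : TangentBundle 𝓘(ℝ, E) M → ℝ}
    {v : TangentBundle 𝓘(ℝ, E) M} (hL : ContMDiffAt 𝓘(ℝ, E).tangent 𝓘(ℝ, ℝ) ∞ L v) :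
    ContDiffAt ℝ ∞ (fun x : E × E => fderiv ℝ (fderiv ℝ (localRep L v.1 x.1)) x.2)
      (extChartAt 𝓘(ℝ, E) v.1 v.1, fibreCoord v.1 v) :=
  contDiffAt_fderiv_snd (f := fun x => fderiv ℝ (localRep L v.1 x))
    (contDiffAt_fderiv_snd (contDiffAt_localRep hL))

set_option maxSynthPendingDepth 3 in
theorem contDiffAt_fderiv_fderiv_fderiv_localRep {L : TangentBundle 𝓘(ℝ, E) M → ℝ}
    {v : TangentBundle 𝓘(ℝ, E) M} (hL : ContMDiffAt 𝓘(ℝ, E).tangent 𝓘(ℝ, ℝ) ∞ L v) :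
    ContDiffAt ℝ ∞ (fun x : E × E => fderiv ℝ (fderiv ℝ (fderiv ℝ (localRep L v.1 x.1))) x.2)
      (extChartAt 𝓘(ℝ, E) v.1 v.1, fibreCoord v.1 v) :=
  contDiffAt_fderiv_snd (f := fun x => fderiv ℝ (fderiv ℝ (localRep L v.1 x)))
    (contDiffAt_fderiv_fderiv_localRep hL)

theorem continuousAt_coord (v : TangentBundle 𝓘(ℝ, E) M) :
    ContinuousAt (fun w : TangentBundle 𝓘(ℝ, E) M =>
      (extChartAt 𝓘(ℝ, E) v.1 w.1, fibreCoord v.1 w)) v := by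
  have ht : v ∈ (trivializationAt E (TangentSpace 𝓘(ℝ, E) : M → Type _) v.1).source :=
    FiberBundle.mem_trivializationAt_proj_source
  have h1 : ContinuousAt (trivializationAt E (TangentSpace 𝓘(ℝ, E) : M → Type _) v.1) v :=
    (Trivialization.toOpenPartialHomeomorph _).continuousAt ht
  refine ContinuousAt.prodMk ?_ (continuous_snd.continuousAt.comp h1)
  exact (continuousAt_extChartAt (I := 𝓘(ℝ, E)) v.1).comp
    (FiberBundle.continuous_proj E (TangentSpace 𝓘(ℝ, E) : M → Type _)).continuousAt

theorem eventually_mem_chart_source (v : TangentBundle 𝓘(ℝ, E) M) :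
    ∀ᶠ w : TangentBundle 𝓘(ℝ, E) M in 𝓝 v, w.1 ∈ (chartAt E v.1).source :=
  (FiberBundle.continuous_proj E (TangentSpace 𝓘(ℝ, E) : M → Type _)).continuousAt.eventually
    ((chartAt E v.1).open_source.mem_nhds (mem_chart_source E v.1))

/-- A function that is smooth near `v` is smooth in coordinates near `v`. -/
theorem eventually_contDiffAt_localRep {L : TangentBundle 𝓘(ℝ, E) M → ℝ}
    {v : TangentBundle 𝓘(ℝ, E) M} (hL : ContMDiffAt 𝓘(ℝ, E).tangent 𝓘(ℝ, ℝ) ∞ L v) :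
    ∀ᶠ w : TangentBundle 𝓘(ℝ, E) M in 𝓝 v,
      ContDiffAt ℝ 3 (localRep L v.1 (extChartAt 𝓘(ℝ, E) v.1 w.1)) (fibreCoord v.1 w) := by
  have h1 := ((contDiffAt_localRep hL).of_le (m := 3) (WithTop.coe_le_coe.2 le_top)).eventually
    (by simp)
  filter_upwards [(continuousAt_coord v).eventually h1] with w hw
  exact ContDiffAt.comp (g := fun x : E × E => localRep L v.1 x.1 x.2)
    (f := fun z : E => (extChartAt 𝓘(ℝ, E) v.1 w.1, z)) (fibreCoord v.1 w) hw (by fun_prop)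

theorem contDiffAt_fibre {L : TangentBundle 𝓘(ℝ, E) M → ℝ}
    {v : TangentBundle 𝓘(ℝ, E) M} (hL : ContMDiffAt 𝓘(ℝ, E).tangent 𝓘(ℝ, ℝ) ∞ L v) :
    ContDiffAt ℝ ∞ (fun y : E => L ⟨v.1, y⟩) v.2 := by
  have hv := mem_chart_source E v.1
  have h1 : (fun y : E => L ⟨v.1, y⟩) = fun y : E => localRep L v.1
      (extChartAt 𝓘(ℝ, E) v.1 v.1) (fibreCoordEquiv v.1 v.1 hv y) :=
    funext fun y => apply_eq_localRep L hv y
  rw [h1]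
  exact ContDiffAt.comp (g := fun x : E × E => localRep L v.1 x.1 x.2)
    (f := fun y : E => (extChartAt 𝓘(ℝ, E) v.1 v.1, fibreCoordEquiv v.1 v.1 hv y)) v.2
    (contDiffAt_localRep hL) (by fun_prop)

/-- A bundle chart acts on each fibre by a linear isomorphism, so the second derivative transforms
tensorially. This moves the dependence on the base point into the jointly smooth function
`localRep`. -/
theorem fundamentalTensor_eq_localRep (L : TangentBundle 𝓘(ℝ, E) M → ℝ) {p₀ q : M}
    (hq : q ∈ (chartAt E p₀).source) (y u w : TangentSpace 𝓘(ℝ, E) q)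
    (hL : ContDiffAt ℝ 3 (localRep L p₀ (extChartAt 𝓘(ℝ, E) p₀ q)) (fibreCoord p₀ ⟨q, y⟩)) :
    fundamentalTensor L ⟨q, y⟩ u w = 1 / 2 *
      fderiv ℝ (fderiv ℝ (localRep L p₀ (extChartAt 𝓘(ℝ, E) p₀ q))) (fibreCoord p₀ ⟨q, y⟩)
        (fibreCoord p₀ ⟨q, u⟩) (fibreCoord p₀ ⟨q, w⟩) := by
  have h1 : (fun y : E => L ⟨q, y⟩) = fun y : E => localRep L p₀
      (extChartAt 𝓘(ℝ, E) p₀ q) (fibreCoordEquiv p₀ q hq y) :=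
    funext fun y => apply_eq_localRep L hq y
  have h2 := fderiv_fderiv_comp_equiv_apply (fibreCoordEquiv p₀ q hq) (y := y)
    (hL.of_le (m := 2) (by norm_num)) u w
  rw [← h1] at h2
  exact congrArg ((1 / 2 : ℝ) * ·) h2

theorem cartanTensor_eq_localRep (L : TangentBundle 𝓘(ℝ, E) M → ℝ) {p₀ q : M}
    (hq : q ∈ (chartAt E p₀).source) (y a b c : TangentSpace 𝓘(ℝ, E) q)
    (hL : ContDiffAt ℝ 3 (localRep L p₀ (extChartAt 𝓘(ℝ, E) p₀ q)) (fibreCoord p₀ ⟨q, y⟩)) :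
    cartanTensor L ⟨q, y⟩ a b c = 1 / 4 *
      fderiv ℝ (fderiv ℝ (fderiv ℝ (localRep L p₀ (extChartAt 𝓘(ℝ, E) p₀ q))))
        (fibreCoord p₀ ⟨q, y⟩)
        (fibreCoord p₀ ⟨q, a⟩) (fibreCoord p₀ ⟨q, b⟩) (fibreCoord p₀ ⟨q, c⟩) := by
  have h1 : (fun y : E => L ⟨q, y⟩) = fun y : E => localRep L p₀
      (extChartAt 𝓘(ℝ, E) p₀ q) (fibreCoordEquiv p₀ q hq y) :=
    funext fun y => apply_eq_localRep L hq y
  have h2 := fderiv_fderiv_fderiv_comp_equiv_apply (fibreCoordEquiv p₀ q hq) (y := y) hL a b c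
  rw [← h1] at h2
  exact congrArg ((1 / 4 : ℝ) * ·) h2

variable {U : Opens M}

theorem contMDiffAt_fibreCoord (X : VectorFields E U) {p : M} (hp : p ∈ U) :
    ContMDiffAt 𝓘(ℝ, E) 𝓘(ℝ, E) ∞ (fun q => fibreCoord p ⟨q, X q⟩) p :=
  (contMDiffAt_section p).1 (X.contMDiffAt hp)

theorem contMDiffAt_coord (X : VectorFields E U) {p : M} (hp : p ∈ U) :
    ContMDiffAt 𝓘(ℝ, E) 𝓘(ℝ, E × E) ∞
      (fun q => (extChartAt 𝓘(ℝ, E) p q, fibreCoord p ⟨q, X q⟩)) p :=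
  ContMDiffAt.prodMk_space contMDiffAt_extChartAt (contMDiffAt_fibreCoord X hp)

theorem eventually_contDiffAt_localRep_field {L : TangentBundle 𝓘(ℝ, E) M → ℝ}
    (V : VectorFields E U) {p : M} (hp : p ∈ U)
    (hL : ContMDiffAt 𝓘(ℝ, E).tangent 𝓘(ℝ, ℝ) ∞ L ⟨p, V p⟩) :
    ∀ᶠ q in 𝓝 p, q ∈ (chartAt E p).source ∧
      ContDiffAt ℝ 3 (localRep L p (extChartAt 𝓘(ℝ, E) p q)) (fibreCoord p ⟨q, V q⟩) := by
  filter_upwards [(V.contMDiffAt hp).continuousAt.eventually (eventually_contDiffAt_localRep hL),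
    (chartAt E p).open_source.mem_nhds (mem_chart_source E p)] with q hq hq' using ⟨hq', hq⟩

theorem contMDiffAt_fundamentalTensor {L : TangentBundle 𝓘(ℝ, E) M → ℝ}
    (V X Y : VectorFields E U) {p : M} (hp : p ∈ U)
    (hL : ContMDiffAt 𝓘(ℝ, E).tangent 𝓘(ℝ, ℝ) ∞ L ⟨p, V p⟩) :
    ContMDiffAt 𝓘(ℝ, E) 𝓘(ℝ, ℝ) ∞ (fun q => fundamentalTensor L ⟨q, V q⟩ (X q) (Y q)) p := by
  have h1 := contDiffAt_fderiv_fderiv_localRep hL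
  have h2 : ContMDiffAt 𝓘(ℝ, E) 𝓘(ℝ, E →L[ℝ] E →L[ℝ] ℝ) ∞
      (fun q => fderiv ℝ (fderiv ℝ (localRep L p (extChartAt 𝓘(ℝ, E) p q)))
        (fibreCoord p ⟨q, V q⟩)) p :=
    ContMDiffAt.comp (I' := 𝓘(ℝ, E × E)) (f := fun q => (extChartAt 𝓘(ℝ, E) p q,
      fibreCoord p ⟨q, V q⟩)) p h1.contMDiffAt (contMDiffAt_coord V hp)
  have h3 := (h2.clm_apply (contMDiffAt_fibreCoord X hp)).clm_apply (contMDiffAt_fibreCoord Y hp)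
  refine (contMDiffAt_const (c := (1 / 2 : ℝ)).mul h3).congr_of_eventuallyEq ?_
  filter_upwards [eventually_contDiffAt_localRep_field V hp hL] with q hq
  exact fundamentalTensor_eq_localRep L hq.1 _ _ _ hq.2

set_option maxSynthPendingDepth 3 in
theorem contMDiffAt_cartanTensor {L : TangentBundle 𝓘(ℝ, E) M → ℝ}
    (V X Y Z : VectorFields E U) {p : M} (hp : p ∈ U)
    (hL : ContMDiffAt 𝓘(ℝ, E).tangent 𝓘(ℝ, ℝ) ∞ L ⟨p, V p⟩) :
    ContMDiffAt 𝓘(ℝ, E) 𝓘(ℝ, ℝ) ∞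
      (fun q => cartanTensor L ⟨q, V q⟩ (X q) (Y q) (Z q)) p := by
  have h1 := contDiffAt_fderiv_fderiv_fderiv_localRep hL
  have h2 : ContMDiffAt 𝓘(ℝ, E) 𝓘(ℝ, E →L[ℝ] E →L[ℝ] E →L[ℝ] ℝ) ∞
      (fun q => fderiv ℝ (fderiv ℝ (fderiv ℝ (localRep L p (extChartAt 𝓘(ℝ, E) p q))))
        (fibreCoord p ⟨q, V q⟩)) p :=
    ContMDiffAt.comp (I' := 𝓘(ℝ, E × E)) (f := fun q => (extChartAt 𝓘(ℝ, E) p q,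
      fibreCoord p ⟨q, V q⟩)) p h1.contMDiffAt (contMDiffAt_coord V hp)
  have h3 := ((h2.clm_apply (contMDiffAt_fibreCoord X hp)).clm_apply
    (contMDiffAt_fibreCoord Y hp)).clm_apply (contMDiffAt_fibreCoord Z hp)
  refine (contMDiffAt_const (c := (1 / 4 : ℝ)).mul h3).congr_of_eventuallyEq ?_
  filter_upwards [eventually_contDiffAt_localRep_field V hp hL] with q hq
  exact cartanTensor_eq_localRep L hq.1 _ _ _ _ hq.2

end Coordinates

/-! ### Symmetry and Euler identities on the closed cone -/

section Pointwise

variable {E : Type*} [NormedAddCommGroup E] [NormedSpace ℝ E]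
  {M : Type*} [TopologicalSpace M] [ChartedSpace E M] [IsManifold 𝓘(ℝ, E) ∞ M]

theorem fundamentalTensor_symm {L : TangentBundle 𝓘(ℝ, E) M → ℝ} {v : TangentBundle 𝓘(ℝ, E) M}
    (hL : ContMDiffAt 𝓘(ℝ, E).tangent 𝓘(ℝ, ℝ) ∞ L v) (u w : E) :
    fundamentalTensor L v u w = fundamentalTensor L v w u :=
  congrArg ((1 / 2 : ℝ) * ·) (((contDiffAt_fibre hL).isSymmSndFDerivAt two_le_smooth).eq u w)

theorem cartanTensor_swap_right {L : TangentBundle 𝓘(ℝ, E) M → ℝ} {v : TangentBundle 𝓘(ℝ, E) M}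
    (hL : ContMDiffAt 𝓘(ℝ, E).tangent 𝓘(ℝ, ℝ) ∞ L v) (a b c : E) :
    cartanTensor L v a b c = cartanTensor L v a c b :=
  congrArg ((1 / 4 : ℝ) * ·) (fderiv_fderiv_fderiv_swap_right (contDiffAt_fibre hL) a b c)

namespace FinslerSpacetime

variable (S : FinslerSpacetime E M)

theorem contMDiffAt_L {v : TangentBundle 𝓘(ℝ, E) M} (hv : v ∈ slitClosure S.A) :
    ContMDiffAt 𝓘(ℝ, E).tangent 𝓘(ℝ, ℝ) ∞ S.L v := by
  obtain ⟨Ω, hΩ, hsub, h⟩ := S.smooth_L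
  exact h.contMDiffAt (hΩ.mem_nhds (hsub hv))

theorem subset_slitClosure : S.A ⊆ slitClosure S.A :=
  fun v hv => ⟨subset_closure hv, S.ne_zero v hv⟩

theorem isOpen_fibre (p : M) : IsOpen {y : E | (⟨p, y⟩ : TangentBundle 𝓘(ℝ, E) M) ∈ S.A} :=
  S.isOpen_A.preimage (FiberBundle.continuous_totalSpaceMk E (TangentSpace 𝓘(ℝ, E) : M → Type _) p)

/-- Homogeneity of `L` is known only on the closed cone, not for its extension beyond it. Euler's
relation is therefore differentiated inside the open cone, and boundary vectors are reached by
continuity. -/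
theorem fundamentalTensor_self_of_mem {v : TangentBundle 𝓘(ℝ, E) M} (hv : v ∈ S.A) :
    fundamentalTensor S.L v v.2 v.2 = S.L v := by
  have hf : ∀ y ∈ {y : E | (⟨v.1, y⟩ : TangentBundle 𝓘(ℝ, E) M) ∈ S.A},
      ContDiffAt ℝ ∞ (fun y : E => S.L ⟨v.1, y⟩) y := fun y hy =>
    contDiffAt_fibre (v := ⟨v.1, y⟩) (S.contMDiffAt_L (S.subset_slitClosure hy))
  have hom : ∀ y ∈ {y : E | (⟨v.1, y⟩ : TangentBundle 𝓘(ℝ, E) M) ∈ S.A}, ∀ c : ℝ, 0 < c →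
      (fun y : E => S.L ⟨v.1, y⟩) (c • y) = c ^ 2 * (fun y : E => S.L ⟨v.1, y⟩) y :=
    fun y hy c hc => S.homogeneous_L _ (S.subset_slitClosure hy) c hc
  have h1 := fderiv_fderiv_apply_self_of_homogeneous (S.isOpen_fibre v.1) hf hom (y := v.2) hv v.2
  have h2 := fderiv_self_of_homogeneous ((hf v.2 hv).differentiableAt (by simp)) (hom v.2 hv)
  have h3 : fundamentalTensor S.L v v.2 v.2 = 1 / 2 * (2 * S.L v) :=
    congrArg ((1 / 2 : ℝ) * ·) (h1.trans h2)
  rw [h3]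
  ring

theorem cartanTensor_self_of_mem {v : TangentBundle 𝓘(ℝ, E) M} (hv : v ∈ S.A) (a b : E) :
    cartanTensor S.L v a b v.2 = 0 := by
  have hf : ∀ y ∈ {y : E | (⟨v.1, y⟩ : TangentBundle 𝓘(ℝ, E) M) ∈ S.A},
      ContDiffAt ℝ ∞ (fun y : E => S.L ⟨v.1, y⟩) y := fun y hy =>
    contDiffAt_fibre (v := ⟨v.1, y⟩) (S.contMDiffAt_L (S.subset_slitClosure hy))
  have hom : ∀ y ∈ {y : E | (⟨v.1, y⟩ : TangentBundle 𝓘(ℝ, E) M) ∈ S.A}, ∀ c : ℝ, 0 < c →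
      (fun y : E => S.L ⟨v.1, y⟩) (c • y) = c ^ 2 * (fun y : E => S.L ⟨v.1, y⟩) y :=
    fun y hy c hc => S.homogeneous_L _ (S.subset_slitClosure hy) c hc
  have h1 := fderiv_fderiv_fderiv_apply_self_of_homogeneous (S.isOpen_fibre v.1) hf hom
    (y := v.2) hv a b
  exact (congrArg ((1 / 4 : ℝ) * ·) h1).trans (mul_zero _)

/-- A function on `TM` that vanishes on `A` vanishes at those points of `Ā` at which it agrees
locally with a continuous function. -/
theorem eq_zero_of_continuousAt {v : TangentBundle 𝓘(ℝ, E) M} (hv : v ∈ slitClosure S.A)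
    {F : TangentBundle 𝓘(ℝ, E) M → ℝ} (hF : ContinuousAt F v)
    (h : ∀ᶠ w in 𝓝 v, w ∈ S.A → F w = 0) : F v = 0 := by
  have hne : (𝓝[S.A] v).NeBot := mem_closure_iff_nhdsWithin_neBot.1 hv.1
  have h1 : Filter.Tendsto F (𝓝[S.A] v) (𝓝 (F v)) := hF.mono_left nhdsWithin_le_nhds
  have h2 : Filter.Tendsto F (𝓝[S.A] v) (𝓝 0) := by
    refine tendsto_const_nhds.congr' ?_
    filter_upwards [nhdsWithin_le_nhds h, self_mem_nhdsWithin] with w hw hwA using (hw hwA).symm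
  exact tendsto_nhds_unique h1 h2

/-- `g_v(v, v) = L(v)` on `Ā`. -/
theorem fundamentalTensor_self {v : TangentBundle 𝓘(ℝ, E) M} (hv : v ∈ slitClosure S.A) :
    fundamentalTensor S.L v v.2 v.2 = S.L v := by
  have hL := S.contMDiffAt_L hv
  have h1 := contDiffAt_fderiv_fderiv_localRep hL
  have hco := continuousAt_coord v
  have h2 : ContinuousAt (fun w : TangentBundle 𝓘(ℝ, E) M =>
      fderiv ℝ (fderiv ℝ (localRep S.L v.1 (extChartAt 𝓘(ℝ, E) v.1 w.1))) (fibreCoord v.1 w)) v :=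
    ContinuousAt.comp (f := fun w : TangentBundle 𝓘(ℝ, E) M =>
      (extChartAt 𝓘(ℝ, E) v.1 w.1, fibreCoord v.1 w)) h1.continuousAt hco
  have hsnd : ContinuousAt (fun w : TangentBundle 𝓘(ℝ, E) M => fibreCoord v.1 w) v := hco.snd
  have h3 := (continuousAt_const (y := (1 / 2 : ℝ))).mul ((h2.clm_apply hsnd).clm_apply hsnd)
  have hev := eventually_contDiffAt_localRep hL
  have hch := eventually_mem_chart_source v
  have := S.eq_zero_of_continuousAt hv (h3.sub hL.continuousAt) (by
    filter_upwards [hev, hch] with w hw hwc hwA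
    exact sub_eq_zero.2 ((fundamentalTensor_eq_localRep S.L hwc w.2 w.2 w.2 hw).symm.trans
      (S.fundamentalTensor_self_of_mem hwA)))
  rw [← sub_eq_zero, ← this]
  congr 1
  exact fundamentalTensor_eq_localRep S.L hch.self_of_nhds v.2 v.2 v.2 hev.self_of_nhds

set_option maxSynthPendingDepth 3 in
/-- `C_v(·, ·, v) = 0` on `Ā`. -/
theorem cartanTensor_self {v : TangentBundle 𝓘(ℝ, E) M} (hv : v ∈ slitClosure S.A) (a b : E) :
    cartanTensor S.L v a b v.2 = 0 := by
  have hL := S.contMDiffAt_L hv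
  have h1 := contDiffAt_fderiv_fderiv_fderiv_localRep hL
  have hco := continuousAt_coord v
  have h2 : ContinuousAt (fun w : TangentBundle 𝓘(ℝ, E) M =>
      fderiv ℝ (fderiv ℝ (fderiv ℝ (localRep S.L v.1 (extChartAt 𝓘(ℝ, E) v.1 w.1))))
        (fibreCoord v.1 w)) v :=
    ContinuousAt.comp (f := fun w : TangentBundle 𝓘(ℝ, E) M =>
      (extChartAt 𝓘(ℝ, E) v.1 w.1, fibreCoord v.1 w)) h1.continuousAt hco
  have hsnd : ContinuousAt (fun w : TangentBundle 𝓘(ℝ, E) M => fibreCoord v.1 w) v := hco.snd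
  have h3 := (continuousAt_const (y := (1 / 4 : ℝ))).mul
    (((h2.clm_apply (continuousAt_const (y := fibreCoord v.1 ⟨v.1, a⟩))).clm_apply
      (continuousAt_const (y := fibreCoord v.1 ⟨v.1, b⟩))).clm_apply hsnd)
  have hev := eventually_contDiffAt_localRep hL
  have hch := eventually_mem_chart_source v
  have := S.eq_zero_of_continuousAt hv h3 (by
    filter_upwards [hev, hch] with w hw hwc hwA
    -- The fixed arguments `a`, `b` are moved to the nearby fibre by keeping their coordinates
    -- constant.
    have hex : ∀ c : E, ∃ a : TangentSpace 𝓘(ℝ, E) w.1, fibreCoord v.1 ⟨w.1, a⟩ = c := fun c =>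
      ⟨(fibreCoordEquiv v.1 w.1 hwc).symm c, (fibreCoordEquiv v.1 w.1 hwc).apply_symm_apply c⟩
    obtain ⟨a', ha⟩ := hex (fibreCoord v.1 ⟨v.1, a⟩)
    obtain ⟨b', hb⟩ := hex (fibreCoord v.1 ⟨v.1, b⟩)
    have h4 := S.cartanTensor_self_of_mem hwA a' b'
    have h5 := cartanTensor_eq_localRep S.L hwc w.2 a' b' w.2 hw
    rw [ha, hb] at h5
    exact h5.symm.trans h4)
  rw [← this]
  exact cartanTensor_eq_localRep S.L hch.self_of_nhds v.2 a b v.2 hev.self_of_nhds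

end FinslerSpacetime

end Pointwise

/-! ### Linear algebra of Lorentzian forms -/

section Lorentz

variable {E : Type*} [NormedAddCommGroup E] [NormedSpace ℝ E] {b : E →L[ℝ] E →L[ℝ] ℝ}

theorem HasLorentzSignature.eq_zero_of_forall (hb : HasLorentzSignature b) {x : E}
    (h : ∀ y, b x y = 0) (hsymm : ∀ x y, b x y = b y x) : x = 0 := by
  obtain ⟨u, hu, hneg⟩ := hb
  by_contra hx
  have := hneg x ((hsymm u x).trans (h u)) hx
  rw [h x] at this
  exact lt_irrefl _ this

/-- A vector orthogonal to a nonzero lightlike vector `n` is spacelike or a multiple of `n`. -/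
theorem HasLorentzSignature.neg_or_mem_span (hb : HasLorentzSignature b)
    (hsymm : ∀ x y, b x y = b y x) {n x : E} (hn : n ≠ 0) (hnn : b n n = 0) (hnx : b n x = 0) :
    b x x < 0 ∨ ∃ c : ℝ, x = c • n := by
  obtain ⟨u, hu, hneg⟩ := hb
  have hun : b u n ≠ 0 := fun h => by
    have := hneg n h hn
    rw [hnn] at this
    exact lt_irrefl _ this
  -- The multiple of `n` is chosen to make the difference orthogonal to the timelike `u`. As `n` is
  -- null and orthogonal to `x`, subtracting it does not change `b x x`.
  by_cases hx : x - (b u x / b u n) • n = 0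
  · exact .inr ⟨_, sub_eq_zero.1 hx⟩
  · left
    have h1 := hneg (x - (b u x / b u n) • n) (by
      simp only [map_sub, map_smul, smul_eq_mul]
      field_simp
      ring) hx
    simpa [hnn, hnx, hsymm x n] using h1

end Lorentz

/-! ### Linear connections, the Koszul formula and curvature symmetries -/

section Connections

variable {E : Type*} [NormedAddCommGroup E] [NormedSpace ℝ E]
  {M : Type*} [TopologicalSpace M] [ChartedSpace E M] [IsManifold 𝓘(ℝ, E) ∞ M]
  {U : Opens M}

namespace IsLinearConnection

variable {Γ : Type*} [AddCommGroup Γ] [Module (SmoothFun E U) Γ] {D : VectorFields E U → Γ → Γ}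

theorem neg_left (hD : IsLinearConnection D) (W : VectorFields E U) (s : Γ) :
    D (-W) s = -D W s := by
  have := hD.smul_left (-1) W s
  simpa using this

theorem zero_right (hD : IsLinearConnection D) (W : VectorFields E U) : D W 0 = 0 := by
  simpa using hD.add_right W 0 0

theorem neg_right (hD : IsLinearConnection D) (W : VectorFields E U) (s : Γ) :
    D W (-s) = -D W s := by
  have := hD.add_right W s (-s)
  rw [add_neg_cancel, hD.zero_right] at this
  exact eq_neg_of_add_eq_zero_right this.symm

theorem sub_right (hD : IsLinearConnection D) (W : VectorFields E U) (s t : Γ) :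
    D W (s - t) = D W s - D W t := by
  rw [sub_eq_add_neg, hD.add_right, hD.neg_right, sub_eq_add_neg]

end IsLinearConnection

variable [FiniteDimensional ℝ E]

/-- The Lie bracket acts on functions as a commutator. -/
theorem dirDeriv_lieBracket (X Y : VectorFields E U) (f : SmoothFun E U) :
    dirDeriv (lieBracket X Y) f = dirDeriv X (dirDeriv Y f) - dirDeriv Y (dirDeriv X f) := by
  -- In the Jacobi identity for X, Y, fZ the terms with first derivatives of f along X or Y cancel.
  -- What remains is the claim multiplied by Z.
  have key : ∀ Z : VectorFields E U, (dirDeriv X (dirDeriv Y f) - dirDeriv Y (dirDeriv X f) -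
      dirDeriv (lieBracket X Y) f) • Z = 0 := fun Z => by
    have h := lieBracket_leibniz X Y (f • Z)
    simp only [lieBracket_smul_right, lieBracket_add_right] at h
    rw [lieBracket_leibniz X Y Z, smul_add] at h
    rw [sub_smul, sub_smul]
    refine Eq.trans ?_ (sub_eq_zero.2 h)
    abel
  ext p
  by_contra hne
  -- If the claim fails at `p`, every field vanishes there; but then so does every directional
  -- derivative, and the claim holds.
  have hz : ∀ Z : VectorFields E U, Z p = 0 := fun Z => by
    have := congrArg (fun W : VectorFields E U => W p) (key Z)
    refine (smul_eq_zero.1 this).resolve_left fun h => hne ?_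
    simp only [SmoothFun.sub_apply] at h ⊢
    linarith
  refine hne ?_
  have hd : ∀ (W : VectorFields E U) (h : SmoothFun E U), dirDeriv W h p = 0 := fun W h => by
    rw [dirDeriv_apply, hz W]
    exact map_zero _
  rw [SmoothFun.sub_apply, hd, hd, hd, sub_zero]

namespace IsLinearConnection

variable {Γ : Type*} [AddCommGroup Γ] [Module (SmoothFun E U) Γ] {D : VectorFields E U → Γ → Γ}

theorem curvature_swap (hD : IsLinearConnection D) (X Y : VectorFields E U) (s : Γ) :
    curvature D X Y s = -curvature D Y X s := by
  rw [curvature, curvature, lieBracket_swap, hD.neg_left]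
  abel

theorem curvature_sub_right (hD : IsLinearConnection D) (X Y : VectorFields E U) (s t : Γ) :
    curvature D X Y (s - t) = curvature D X Y s - curvature D X Y t := by
  simp only [curvature, hD.sub_right]
  abel

theorem curvature_smul_right (hD : IsLinearConnection D) (X Y : VectorFields E U)
    (f : SmoothFun E U) (s : Γ) : curvature D X Y (f • s) = f • curvature D X Y s := by
  simp only [curvature, hD.leibniz, hD.add_right, dirDeriv_lieBracket]
  simp only [smul_sub, sub_smul]
  abel

end IsLinearConnection

section Koszul

variable
  (B : VectorFields E U →ₗ[SmoothFun E U] VectorFields E U →ₗ[SmoothFun E U] SmoothFun E U)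

/-- The Koszul functional: twice the metric product of `∇_X Y` with a vector field. -/
noncomputable def koszul (X Y : VectorFields E U) :
    VectorFields E U →ₗ[SmoothFun E U] SmoothFun E U where
  toFun Z := dirDeriv X (B Y Z) + dirDeriv Y (B X Z) - dirDeriv Z (B X Y) + B (lieBracket X Y) Z
    - B X (lieBracket Y Z) - B Y (lieBracket X Z)
  map_add' Z W := by
    simp only [map_add, dirDeriv_add, dirDeriv_add_left, lieBracket_add_right]
    ring
  map_smul' f Z := by
    simp only [map_smul, map_add, smul_eq_mul, dirDeriv_mul, dirDeriv_smul_left,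
      lieBracket_smul_right, RingHom.id_apply]
    ring

theorem koszul_apply (X Y Z : VectorFields E U) :
    koszul B X Y Z = dirDeriv X (B Y Z) + dirDeriv Y (B X Z) - dirDeriv Z (B X Y)
      + B (lieBracket X Y) Z - B X (lieBracket Y Z) - B Y (lieBracket X Z) := rfl

/-- For a nondegenerate symmetric form `B` and a tensor `T` that is symmetric in its first two
arguments, there is a torsion-free connection whose deviation from being metric is given by `T`. -/
theorem exists_torsionFree_connection [T2Space M]
    (hsymm : ∀ X Y, B X Y = B Y X) (hB : ∀ p ∈ U, ∀ X, (∀ Z, B X Z p = 0) → X p = 0)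
    (T : VectorFields E U →ₗ[SmoothFun E U] VectorFields E U →ₗ[SmoothFun E U]
      VectorFields E U →ₗ[SmoothFun E U] SmoothFun E U) (hT : ∀ X Y, T X Y = T Y X) :
    ∃ D : VectorFields E U → VectorFields E U → VectorFields E U,
      (∀ X Y Z, B (D X Y) Z = SmoothFun.half * koszul B X Y Z + T X Y Z) ∧
      IsLinearConnection D ∧ (∀ X Y, D X Y - D Y X = lieBracket X Y) ∧
      ∀ X Y Z, dirDeriv X (B Y Z) = B (D X Y) Z + B Y (D X Z) - (T X Y Z + T X Z Y) := by
  have hinj : ∀ X Y, (∀ Z, B X Z = B Y Z) → X = Y := fun X Y h =>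
    VectorFields.ext_on fun p hp => sub_eq_zero.1 (hB p hp (X - Y) fun Z => by
      simp [h Z])
  -- The Koszul expression is tensorial in its last slot, hence represented by a field.
  -- Torsion-freeness comes from the symmetry of `T`, and `T` alone accounts for the failure to be
  -- metric.
  choose D hD using fun X Y =>
    exists_representing_field B hB ((SmoothFun.half : SmoothFun E U) • koszul B X Y + T X Y)
  have hDZ : ∀ X Y Z, B (D X Y) Z = SmoothFun.half * koszul B X Y Z + T X Y Z := fun X Y Z => by
    rw [hD]
    rfl
  have h2 := SmoothFun.two_mul_half (E := E) (U := U)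
  refine ⟨D, hDZ, ⟨?_, ?_, ?_, ?_⟩, ?_, ?_⟩
  · refine fun X X' Y => hinj _ _ fun Z => ?_
    simp only [map_add, LinearMap.add_apply, hDZ, koszul_apply, dirDeriv_add, dirDeriv_add_left,
      lieBracket_add_left]
    ring
  · refine fun f X Y => hinj _ _ fun Z => ?_
    simp only [map_smul, map_add, LinearMap.add_apply, LinearMap.smul_apply, hDZ, koszul_apply,
      smul_eq_mul, dirDeriv_mul, dirDeriv_smul_left, lieBracket_smul_left]
    rw [hsymm Y X]
    ring
  · refine fun X Y Y' => hinj _ _ fun Z => ?_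
    simp only [map_add, LinearMap.add_apply, hDZ, koszul_apply, dirDeriv_add, dirDeriv_add_left,
      lieBracket_add_left, lieBracket_add_right]
    ring
  · refine fun X f Y => hinj _ _ fun Z => ?_
    simp only [map_smul, map_add, LinearMap.add_apply, LinearMap.smul_apply, hDZ, koszul_apply,
      smul_eq_mul, dirDeriv_mul, dirDeriv_smul_left, lieBracket_smul_left, lieBracket_smul_right]
    linear_combination (dirDeriv X f * B Y Z) * h2
  · refine fun X Y => hinj _ _ fun Z => ?_
    simp only [map_sub, LinearMap.sub_apply, hDZ, koszul_apply, hT Y X]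
    rw [hsymm Y X, lieBracket_swap Y X, map_neg, LinearMap.neg_apply]
    linear_combination (B (lieBracket X Y) Z) * h2
  · intro X Y Z
    rw [hsymm Y (D X Z), hDZ, hDZ, koszul_apply, koszul_apply, hsymm Z Y,
      lieBracket_swap Z Y, map_neg, hsymm (lieBracket X Y) Z, hsymm (lieBracket X Z) Y]
    linear_combination (-dirDeriv X (B Y Z)) * h2

end Koszul

section Curvature

variable
  {B : VectorFields E U →ₗ[SmoothFun E U] VectorFields E U →ₗ[SmoothFun E U] SmoothFun E U}
  {D : VectorFields E U → VectorFields E U → VectorFields E U}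

/-- The first Bianchi identity. -/
theorem curvature_bianchi (hD : IsLinearConnection D)
    (htor : ∀ X Y, D X Y - D Y X = lieBracket X Y) (X Y Z : VectorFields E U) :
    curvature D X Y Z + curvature D Y Z X + curvature D Z X Y = 0 := by
  -- Using torsion-freeness twice turns the Bianchi sum into the Jacobi sum.
  have e : ∀ X Y Z, D X (D Y Z) - D X (D Z Y) - D (lieBracket Y Z) X =
      lieBracket X (lieBracket Y Z) := fun X Y Z => by
    rw [← hD.sub_right, htor, htor]
  have hj := lieBracket_leibniz X Y Z
  rw [lieBracket_swap (lieBracket X Y) Z, lieBracket_swap X Z, ← neg_one_smul (SmoothFun E U)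
    (lieBracket Z X), lieBracket_smul_right] at hj
  have h0 : dirDeriv Y (-1 : SmoothFun E U) = 0 := by
    have := dirDeriv_mul Y (1 : SmoothFun E U) 1
    rw [dirDeriv_neg, neg_eq_zero]
    simpa using this
  rw [h0, zero_smul, zero_add, neg_one_smul, ← e, ← e, ← e] at hj
  rw [← sub_eq_zero] at hj
  rw [← hj, curvature, curvature, curvature]
  abel

/-- Apply the commutator formula for [X, Y] to the function B(Z, W); the mixed products of first
derivatives cancel. -/
theorem curvature_metric_swap
    (hmet : ∀ X Y Z, dirDeriv X (B Y Z) = B (D X Y) Z + B Y (D X Z))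
    (X Y Z W : VectorFields E U) : B (curvature D X Y Z) W = -B Z (curvature D X Y W) := by
  have h := dirDeriv_lieBracket X Y (B Z W)
  simp only [hmet, dirDeriv_add] at h
  simp only [curvature, map_sub, LinearMap.sub_apply]
  linear_combination -h

/-- The symmetry of the curvature tensor of a metric torsion-free connection under the exchange of
pairs. -/
theorem curvature_pair_symm (hD : IsLinearConnection D) (hsymm : ∀ X Y, B X Y = B Y X)
    (htor : ∀ X Y, D X Y - D Y X = lieBracket X Y)
    (hmet : ∀ X Y Z, dirDeriv X (B Y Z) = B (D X Y) Z + B Y (D X Z))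
    (X Y Z W : VectorFields E U) :
    B (curvature D X Y Z) W = B (curvature D Z W X) Y := by
  have hb : ∀ X Y Z W, B (curvature D X Y Z) W + B (curvature D Y Z X) W +
      B (curvature D Z X Y) W = 0 := fun X Y Z W => by
    rw [← LinearMap.add_apply, ← map_add, ← LinearMap.add_apply, ← map_add,
      curvature_bianchi hD htor, map_zero, LinearMap.zero_apply]
  have hs : ∀ X Y Z W, B (curvature D X Y Z) W = -B (curvature D Y X Z) W := fun X Y Z W => by
    rw [hD.curvature_swap, map_neg, LinearMap.neg_apply]
  have hm : ∀ X Y Z W, B (curvature D X Y Z) W = -B (curvature D X Y W) Z := fun X Y Z W => by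
    rw [curvature_metric_swap hmet, hsymm]
  have h2 := SmoothFun.two_mul_half (E := E) (U := U)
  -- The octahedron argument: a signed sum of four Bianchi identities, reduced by the two
  -- antisymmetries, leaves twice the difference.
  have key : 2 * (B (curvature D X Y Z) W - B (curvature D Z W X) Y) = 0 := by
    linear_combination hb Z X Y W - hb X Y W Z - hb Y W Z X + hb W Z X Y
      + hm X Y Z W + hm Y W X Z - hm Z X Y W - hs Y Z X W + hm Z Y X W + hs W X Y Z - hm X W Y Z
      + hm W Z X Y - 2 * hs Z W X Y
  have : SmoothFun.half * (2 * (B (curvature D X Y Z) W - B (curvature D Z W X) Y)) = 0 := by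
    rw [key, mul_zero]
  rw [← sub_eq_zero]
  linear_combination this - (B (curvature D X Y Z) W - B (curvature D Z W X) Y) * h2

end Curvature

end Connections

namespace FinslerSpacetime

/-! ### The tensors g_V and C_V over the ring of smooth functions -/

section Metric

variable {E : Type*} [NormedAddCommGroup E] [NormedSpace ℝ E]
  {M : Type*} [TopologicalSpace M] [ChartedSpace E M] [IsManifold 𝓘(ℝ, E) ∞ M]
  {S : FinslerSpacetime E M} {U : Opens M} {V : VectorFields E U}

/-- The metric `g_V` as a bilinear form on vector fields. -/
noncomputable def metric (hV : S.IsAdmissible V) :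
    VectorFields E U →ₗ[SmoothFun E U] VectorFields E U →ₗ[SmoothFun E U] SmoothFun E U :=
  LinearMap.mk₂ (SmoothFun E U)
    (fun X Y => .mk (fun p => S.g V p (X p) (Y p)) fun p hp =>
      contMDiffAt_fundamentalTensor V X Y hp (S.contMDiffAt_L (hV p hp)))
    (fun X X' Y => SmoothFun.ext fun p => LinearMap.map_add₂ (S.g V p) (X p) (X' p) (Y p))
    (fun f X Y => SmoothFun.ext fun p => LinearMap.map_smul₂ (S.g V p) (f p) (X p) (Y p))
    (fun X Y Y' => SmoothFun.ext fun p => map_add (S.g V p (X p)) (Y p) (Y' p))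
    (fun f X Y => SmoothFun.ext fun p => map_smul (S.g V p (X p)) (f p) (Y p))

theorem g_symm (hV : S.IsAdmissible V) {p : M} (hp : p ∈ U) (x y : TangentSpace 𝓘(ℝ, E) p) :
    S.g V p x y = S.g V p y x :=
  fundamentalTensor_symm (S.contMDiffAt_L (hV p hp)) x y

theorem metric_symm (hV : S.IsAdmissible V) (X Y : VectorFields E U) :
    metric hV X Y = metric hV Y X := by
  ext p
  by_cases hp : p ∈ U
  · exact g_symm hV hp _ _
  · rw [linearMap_apply_of_notMem _ hp, linearMap_apply_of_notMem _ hp]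

theorem g_nondegenerate (hV : S.IsAdmissible V) {p : M} (hp : p ∈ U)
    {x : TangentSpace 𝓘(ℝ, E) p} (h : ∀ y, S.g V p x y = 0) : x = 0 :=
  (S.signature _ (hV p hp)).eq_zero_of_forall h (g_symm hV hp)

set_option maxSynthPendingDepth 3 in
/-- The Cartan tensor `C_V` as a trilinear form on vector fields. -/
noncomputable def cartan (hV : S.IsAdmissible V) :
    VectorFields E U →ₗ[SmoothFun E U] VectorFields E U →ₗ[SmoothFun E U]
      VectorFields E U →ₗ[SmoothFun E U] SmoothFun E U :=
  LinearMap.mk₂ (SmoothFun E U)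
    (fun X Y =>
      { toFun := fun Z => .mk (fun p => S.C V p (X p) (Y p) (Z p)) fun p hp =>
          contMDiffAt_cartanTensor V X Y Z hp (S.contMDiffAt_L (hV p hp))
        map_add' := fun Z Z' => SmoothFun.ext fun p =>
          map_add (cartanTensor S.L ⟨p, V p⟩ (X p) (Y p)) (Z p) (Z' p)
        map_smul' := fun f Z => SmoothFun.ext fun p =>
          map_smul (cartanTensor S.L ⟨p, V p⟩ (X p) (Y p)) (f p) (Z p) })
    (fun X X' Y => LinearMap.ext fun Z => SmoothFun.ext fun p =>
      congrArg (fun T : E →L[ℝ] E →L[ℝ] ℝ => T (Y p) (Z p))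
        (map_add (cartanTensor S.L ⟨p, V p⟩) (X p) (X' p)))
    (fun f X Y => LinearMap.ext fun Z => SmoothFun.ext fun p =>
      congrArg (fun T : E →L[ℝ] E →L[ℝ] ℝ => T (Y p) (Z p))
        (map_smul (cartanTensor S.L ⟨p, V p⟩) (f p) (X p)))
    (fun X Y Y' => LinearMap.ext fun Z => SmoothFun.ext fun p =>
      congrArg (fun T : E →L[ℝ] ℝ => T (Z p))
        (map_add (cartanTensor S.L ⟨p, V p⟩ (X p)) (Y p) (Y' p)))
    (fun f X Y => LinearMap.ext fun Z => SmoothFun.ext fun p =>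
      congrArg (fun T : E →L[ℝ] ℝ => T (Z p))
        (map_smul (cartanTensor S.L ⟨p, V p⟩ (X p)) (f p) (Y p)))

theorem cartan_swap_right (hV : S.IsAdmissible V) (X Y Z : VectorFields E U) :
    cartan hV X Y Z = cartan hV X Z Y := by
  ext p
  by_cases hp : p ∈ U
  · exact cartanTensor_swap_right (S.contMDiffAt_L (hV p hp)) _ _ _
  · rw [linearMap_apply_of_notMem _ hp, linearMap_apply_of_notMem _ hp]

theorem cartan_self (hV : S.IsAdmissible V) (X Y : VectorFields E U) : cartan hV X Y V = 0 := by
  ext p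
  by_cases hp : p ∈ U
  · exact S.cartanTensor_self (hV p hp) _ _
  · rw [linearMap_apply_of_notMem _ hp]
    rfl

theorem metric_self_of_isLightlike (hV : S.IsLightlike V) : metric hV.1 V V = 0 := by
  ext p
  by_cases hp : p ∈ U
  · exact (S.fundamentalTensor_self (hV.1 p hp)).trans (hV.2 p hp)
  · rw [linearMap_apply_of_notMem _ hp]
    rfl

theorem metric_of_isGradient {f : SmoothFun E U} (hf : S.IsGradient f V) (X : VectorFields E U) :
    metric hf.1 V X = dirDeriv X f := by
  ext p
  by_cases hp : p ∈ U
  · exact hf.2 p hp (X p)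
  · rw [linearMap_apply_of_notMem _ hp, dirDeriv_apply_of_notMem _ _ hp]

variable [FiniteDimensional ℝ E] [T2Space M]

theorem metric_nondegenerate_at (hV : S.IsAdmissible V) (p : M) (hp : p ∈ U)
    (X : VectorFields E U) (h : ∀ Z, metric hV X Z p = 0) : X p = 0 := by
  refine g_nondegenerate hV hp fun y => ?_
  obtain ⟨Y, rfl⟩ := exists_vectorFields_apply_eq hp y
  exact h Y

theorem metric_nondegenerate (hV : S.IsAdmissible V) {X : VectorFields E U}
    (h : ∀ Z, metric hV X Z = 0) : X = 0 :=
  VectorFields.ext_on fun p hp => metric_nondegenerate_at hV p hp X fun Z => by rw [h Z]; rfl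

end Metric

/-! ### Existence of the Levi-Civita–Chern connection and its metricity for parallel fields -/

section ChernConnection

variable {E : Type*} [NormedAddCommGroup E] [NormedSpace ℝ E] [FiniteDimensional ℝ E]
  {M : Type*} [TopologicalSpace M] [ChartedSpace E M] [IsManifold 𝓘(ℝ, E) ∞ M]
  {S : FinslerSpacetime E M} {U : Opens M} {N : VectorFields E U}

/-- If `N` is parallel then its Levi-Civita–Chern connection is metric. -/
theorem dirDeriv_metric_of_isParallel (hN : S.IsAdmissible N)
    (hD : S.IsChernConnection N (S.chern N)) (hpar : S.IsParallel N) (X Y Z : VectorFields E U) :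
    dirDeriv X (metric hN Y Z) = metric hN (S.chern N X Y) Z + metric hN Y (S.chern N X Z) := by
  ext p
  by_cases hp : p ∈ U
  · have h : dirDeriv X (metric hN Y Z) p = S.g N p (S.chern N X Y p) (Z p) +
        S.g N p (Y p) (S.chern N X Z p) + 2 * S.C N p (S.chern N X N p) (Y p) (Z p) :=
      hD.almost_compatible X Y Z p hp
    have : S.C N p (S.chern N X N p) (Y p) (Z p) = 0 := by
      have h0 : cartan hN (S.chern N X N) Y Z p = 0 := by
        rw [hpar X, map_zero]
        rfl
      exact h0
    rw [h, this, mul_zero, add_zero]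
    rfl
  · rw [dirDeriv_apply_of_notMem _ _ hp, SmoothFun.add_apply, linearMap_apply_of_notMem _ hp,
      linearMap_apply_of_notMem _ hp, add_zero]

variable [T2Space M]

set_option maxSynthPendingDepth 3 in
/-- A lightlike gradient field has a Levi-Civita–Chern connection. -/
theorem exists_isChernConnection {f : SmoothFun E U} (hgrad : S.IsGradient f N)
    (hlight : S.IsLightlike N) : ∃ D, S.IsChernConnection N D := by
  have hN := hgrad.1
  -- The Levi-Civita connection of g_N, obtained with zero correction.
  obtain ⟨D₀, hk₀, hlin₀, htor₀, hmet₀⟩ := exists_torsionFree_connection (metric hN)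
    (metric_symm hN) (metric_nondegenerate_at hN) 0 fun _ _ => rfl
  replace hmet₀ : ∀ X Y Z, dirDeriv X (metric hN Y Z) =
      metric hN (D₀ X Y) Z + metric hN Y (D₀ X Z) := fun X Y Z => by
    rw [hmet₀]
    simp
  -- the Hessian of `f` is symmetric
  have hhess : ∀ X Y, metric hN (D₀ X N) Y = metric hN (D₀ Y N) X := fun X Y => by
    have h1 := hmet₀ X N Y
    have h2 := hmet₀ Y N X
    rw [metric_of_isGradient hgrad, metric_of_isGradient hgrad] at h1 h2
    have h3 := dirDeriv_lieBracket X Y f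
    rw [← htor₀, sub_eq_add_neg, dirDeriv_add_left, ← neg_one_smul (SmoothFun E U) (D₀ Y X),
      dirDeriv_smul_left] at h3
    linear_combination h2 - h1 - h3
  -- By symmetry of the Hessian, g(D₀_N N, Z) = g(D₀_Z N, N), which is half the derivative of g(N,
  -- N) = L(N) = 0.
  have hNN : D₀ N N = 0 := metric_nondegenerate hN fun Z => by
    have h1 := hmet₀ Z N N
    rw [metric_self_of_isLightlike hlight, dirDeriv_zero, metric_symm hN N (D₀ Z N)] at h1
    rw [hhess]
    linear_combination (-(SmoothFun.half : SmoothFun E U)) * h1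
      - (metric hN (D₀ Z N) N) * SmoothFun.two_mul_half (E := E) (U := U)
  let A : VectorFields E U →ₗ[SmoothFun E U] VectorFields E U :=
    { toFun := fun X => D₀ X N
      map_add' := fun X Y => hlin₀.add_left X Y N
      map_smul' := fun h X => hlin₀.smul_left h X N }
  let Q := (cartan hN).comp A
  have hQ : ∀ X Y Z, Q X Y Z = cartan hN (D₀ X N) Y Z := fun _ _ _ => rfl
  have hQs : ∀ X Y Z, Q X Y Z = Q X Z Y := fun X Y Z => cartan_swap_right hN _ _ _
  -- The Koszul combination of `Q`: it is symmetric in its first two slots, and T(X, Y, Z) + T(X, Z,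
  -- Y) = -2 Q(X, Y, Z), which is the prescribed Cartan term.
  let T := LinearMap.lflip.comp Q.flip - Q - Q.flip
  have hT : ∀ X Y Z, T X Y Z = Q Z X Y - Q X Y Z - Q Y X Z := fun _ _ _ => rfl
  obtain ⟨D, hk, hlin, htor, hmet⟩ := exists_torsionFree_connection (metric hN)
    (metric_symm hN) (metric_nondegenerate_at hN) T fun X Y => LinearMap.ext fun Z => by
      rw [hT, hT, hQs Z X Y]
      ring
  -- The circularity closes here: in T(X, N, Z) two terms vanish because C_N annihilates N, the
  -- third because D₀_N N = 0. So the tensor `Q`, built from D₀N, is the one for DN as well.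
  have hDN : ∀ X, D X N = D₀ X N := fun X => by
    rw [← sub_eq_zero]
    refine metric_nondegenerate hN fun Z => ?_
    have hT0 : T X N Z = 0 := by
      rw [hT, hQ, hQ, hQ, cartan_self, cartan_swap_right, cartan_self, hNN]
      simp
    rw [map_sub, LinearMap.sub_apply, hk, hk₀, hT0]
    simp
  refine ⟨D, hlin, htor, fun X Y Z p hp => ?_⟩
  have h := congrArg (fun h : SmoothFun E U => h p) (hmet X Y Z)
  have hTT : T X Y Z + T X Z Y = -(2 * cartan hN (D X N) Y Z) := by
    rw [hT, hT, hDN, ← hQ, hQs X Z Y, hQs Z X Y]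
    ring
  rw [hTT] at h
  have h2 : (2 : SmoothFun E U) p = 2 := map_ofNat (SmoothFun.eval (E := E) (U := U) p) 2
  simp only [SmoothFun.add_apply, SmoothFun.mul_apply,
    h2, sub_neg_eq_add] at h
  exact h

/-- Existence is all that a choice by `epsilon` needs in order to have the defining properties;
uniqueness plays no role. -/
theorem isChernConnection_chern {f : SmoothFun E U} (hgrad : S.IsGradient f N)
    (hlight : S.IsLightlike N) : S.IsChernConnection N (S.chern N) :=
  Classical.epsilon_spec (exists_isChernConnection hgrad hlight)

end ChernConnection

end FinslerSpacetime

/-! ### Connections induced on submodules and quotients -/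

section QuotientConnection

variable {E : Type*} [NormedAddCommGroup E] [NormedSpace ℝ E]
  {M : Type*} [TopologicalSpace M] [ChartedSpace E M] [IsManifold 𝓘(ℝ, E) ∞ M] {U : Opens M}
  {Γ : Type*} [AddCommGroup Γ] [Module (SmoothFun E U) Γ] {D : VectorFields E U → Γ → Γ}

/-- A connection that preserves a submodule induces a connection on the submodule. -/
def restrictConnection (P : Submodule (SmoothFun E U) Γ) (hP : ∀ W, ∀ s ∈ P, D W s ∈ P)
    (W : VectorFields E U) (s : P) : P := ⟨D W s, hP W s s.2⟩

theorem IsLinearConnection.restrictConnection (hD : IsLinearConnection D)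
    (P : Submodule (SmoothFun E U) Γ) (hP : ∀ W, ∀ s ∈ P, D W s ∈ P) :
    IsLinearConnection (restrictConnection P hP) where
  add_left W W' s := Subtype.ext (hD.add_left W W' s)
  smul_left f W s := Subtype.ext (hD.smul_left f W s)
  add_right W s s' := Subtype.ext (hD.add_right W s s')
  leibniz W f s := Subtype.ext (hD.leibniz W f s)

/-- A connection that preserves a submodule induces a connection on the quotient. -/
noncomputable def quotientConnection (D : VectorFields E U → Γ → Γ)
    (K : Submodule (SmoothFun E U) Γ) (W : VectorFields E U) (s : Γ ⧸ K) : Γ ⧸ K :=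
  Submodule.Quotient.mk (D W (Function.surjInv (Submodule.Quotient.mk_surjective K) s))

theorem quotientConnection_mk (hD : IsLinearConnection D) {K : Submodule (SmoothFun E U) Γ}
    (hK : ∀ W, ∀ s ∈ K, D W s ∈ K) (W : VectorFields E U) (s : Γ) :
    quotientConnection D K W (Submodule.Quotient.mk s) = Submodule.Quotient.mk (D W s) := by
  refine (Submodule.Quotient.eq K).2 ?_
  rw [← hD.sub_right]
  exact hK W _ ((Submodule.Quotient.eq K).1 (Function.surjInv_eq _ _))

theorem IsLinearConnection.quotientConnection (hD : IsLinearConnection D)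
    {K : Submodule (SmoothFun E U) Γ} (hK : ∀ W, ∀ s ∈ K, D W s ∈ K) :
    IsLinearConnection (quotientConnection D K) where
  add_left W W' s := by
    obtain ⟨s, rfl⟩ := Submodule.Quotient.mk_surjective K s
    simp only [quotientConnection_mk hD hK, hD.add_left, Submodule.Quotient.mk_add]
  smul_left f W s := by
    obtain ⟨s, rfl⟩ := Submodule.Quotient.mk_surjective K s
    simp only [quotientConnection_mk hD hK, hD.smul_left, Submodule.Quotient.mk_smul]
  add_right W s s' := by
    obtain ⟨s, rfl⟩ := Submodule.Quotient.mk_surjective K s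
    obtain ⟨s', rfl⟩ := Submodule.Quotient.mk_surjective K s'
    simp only [← Submodule.Quotient.mk_add, quotientConnection_mk hD hK, hD.add_right]
  leibniz W f s := by
    obtain ⟨s, rfl⟩ := Submodule.Quotient.mk_surjective K s
    simp only [← Submodule.Quotient.mk_smul, quotientConnection_mk hD hK, hD.leibniz,
      Submodule.Quotient.mk_add]

theorem isFlat_quotientConnection_iff [FiniteDimensional ℝ E] (hD : IsLinearConnection D)
    {K : Submodule (SmoothFun E U) Γ} (hK : ∀ W, ∀ s ∈ K, D W s ∈ K) :
    IsFlat (quotientConnection D K) ↔ ∀ X Y s, curvature D X Y s ∈ K := by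
  refine forall₂_congr fun X Y => (Submodule.Quotient.mk_surjective K).forall.trans
    (forall_congr' fun s => ?_)
  rw [← Submodule.Quotient.mk_eq_zero K]
  simp only [curvature, quotientConnection_mk hD hK, Submodule.Quotient.mk_sub]

end QuotientConnection

namespace FinslerSpacetime

/-! ### The bundle N^⊥/N and the curvature criterion -/

section PPWave

variable {E : Type*} [NormedAddCommGroup E] [NormedSpace ℝ E]
  {M : Type*} [TopologicalSpace M] [ChartedSpace E M] [IsManifold 𝓘(ℝ, E) ∞ M]
  {S : FinslerSpacetime E M} {U : Opens M} {N : VectorFields E U}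

theorem mem_perp_iff (hN : S.IsAdmissible N) (X : VectorFields E U) :
    X ∈ S.Perp N ↔ metric hN N X = 0 := by
  refine ⟨fun h => SmoothFun.ext fun p => ?_, fun h p _ => ?_⟩
  · by_cases hp : p ∈ U
    · exact h p hp
    · rw [linearMap_apply_of_notMem _ hp]
      rfl
  · exact congrArg (fun f : SmoothFun E U => f p) h

/-- `(g_N(N, Y)) X - (g_N(N, X)) Y` is orthogonal to `N`. -/
theorem smul_sub_smul_mem_perp (hN : S.IsAdmissible N) (X Y : VectorFields E U) :
    metric hN N Y • X - metric hN N X • Y ∈ S.Perp N := by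
  rw [mem_perp_iff hN, map_sub, map_smul, map_smul, smul_eq_mul, smul_eq_mul]
  ring

/-- -g_N on N^⊥ has N in its kernel, so it descends in both arguments; by the Lorentz signature N
spans the whole kernel and the form is positive elsewhere. -/
theorem exists_metric_bar (hlight : S.IsLightlike N) :
    ∃ gbar : (p : U) → LinearMap.BilinForm ℝ (S.QuotFibre N p),
      (∀ (p : U) (x y : S.PerpFibre N p),
        gbar p (Submodule.Quotient.mk x) (Submodule.Quotient.mk y) = -S.g N p x y) ∧
      (∀ p ξ η, gbar p ξ η = gbar p η ξ) ∧
      (∀ p ξ, ξ ≠ 0 → 0 < gbar p ξ ξ) := by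
  have hN := hlight.1
  have hleft : ∀ (p : U) (x : S.PerpFibre N p),
      x ∈ (Submodule.span ℝ {N (p : M)}).submoduleOf (S.PerpFibre N p) →
      ∀ y : S.PerpFibre N p, S.g N p x y = 0 := by
    rintro p x hx y
    obtain ⟨c, hc⟩ := Submodule.mem_span_singleton.1 (Submodule.mem_comap.1 hx)
    have hc' : (x : TangentSpace 𝓘(ℝ, E) (p : M)) = c • N p := hc.symm
    rw [hc', LinearMap.map_smul₂, LinearMap.mem_ker.1 y.2, smul_zero]
  let b : (p : U) → S.PerpFibre N p →ₗ[ℝ] S.PerpFibre N p →ₗ[ℝ] ℝ := fun p =>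
    -(S.g N p).compl₁₂ (S.PerpFibre N p).subtype (S.PerpFibre N p).subtype
  have hb : ∀ p x y, b p x y = -S.g N p x y := fun _ _ _ => rfl
  have hbs : ∀ p x y, b p x y = b p y x := fun p x y => by rw [hb, hb, g_symm hN p.2]
  let b' : (p : U) → S.QuotFibre N p →ₗ[ℝ] S.PerpFibre N p →ₗ[ℝ] ℝ := fun p =>
    Submodule.liftQ _ (b p) fun x hx => LinearMap.mem_ker.2 (LinearMap.ext fun y => by
      rw [hb, hleft p x hx]
      exact neg_zero)
  have hb' : ∀ p x y, b' p (Submodule.Quotient.mk x) y = b p x y := fun _ _ _ => rfl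
  let b'' : (p : U) → LinearMap.BilinForm ℝ (S.QuotFibre N p) := fun p =>
    Submodule.liftQ _ (b' p).flip fun x hx => LinearMap.mem_ker.2 (LinearMap.ext fun ξ => by
      obtain ⟨y, rfl⟩ := Submodule.Quotient.mk_surjective _ ξ
      rw [LinearMap.flip_apply, hb', hbs, hb, hleft p x hx]
      exact neg_zero)
  have hb'' : ∀ (p : U) (x y : S.PerpFibre N p),
      b'' p (Submodule.Quotient.mk x) (Submodule.Quotient.mk y) = b p x y :=
    fun p x y => hbs p y x
  refine ⟨b'', hb'', fun p ξ η => ?_, fun p ξ hξ => ?_⟩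
  · obtain ⟨x, rfl⟩ := Submodule.Quotient.mk_surjective _ ξ
    obtain ⟨y, rfl⟩ := Submodule.Quotient.mk_surjective _ η
    rw [hb'', hb'', hbs]
  · obtain ⟨x, rfl⟩ := Submodule.Quotient.mk_surjective _ ξ
    have hc := hN p p.2
    rw [hb'', hb]
    rcases (S.signature _ hc).neg_or_mem_span (g_symm hN p.2) hc.2
      ((S.fundamentalTensor_self hc).trans (hlight.2 p p.2)) (LinearMap.mem_ker.1 x.2) with h | h
    · exact neg_pos.2 h
    · obtain ⟨c, hcx⟩ := h
      exact (hξ ((Submodule.Quotient.mk_eq_zero _).2 (Submodule.mem_comap.2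
        (Submodule.mem_span_singleton.2 ⟨c, hcx.symm⟩)))).elim

variable [FiniteDimensional ℝ E] [T2Space M]

theorem exists_metric_ne_zero (hN : S.IsAdmissible N) {p : M} (hp : p ∈ U) :
    ∃ V, metric hN N V p ≠ 0 := by
  by_contra! h
  exact (hN p hp).2 (metric_nondegenerate_at hN p hp N h)

/-- A vector field orthogonal to `N^⊥` is a multiple of `N`. -/
theorem mem_span_of_forall_perp (hN : S.IsAdmissible N) {Y : VectorFields E U}
    (hY : ∀ W ∈ S.Perp N, metric hN Y W = 0) : Y ∈ Submodule.span (SmoothFun E U) {N} := by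
  -- Paired with W, this is the orthogonality of Y to the section g(N, V)W - g(N, W)V of N^⊥.
  have key : ∀ V, metric hN N V • Y = metric hN Y V • N := fun V => by
    rw [← sub_eq_zero]
    refine metric_nondegenerate hN fun W => ?_
    have h := hY _ (smul_sub_smul_mem_perp hN W V)
    simp only [map_sub, map_smul, LinearMap.sub_apply, LinearMap.smul_apply, smul_eq_mul] at h ⊢
    linear_combination h
  have hkey : ∀ V q, metric hN N V q • Y q = metric hN Y V q • N q := fun V q =>
    congrArg (fun X : VectorFields E U => X q) (key V)
  choose! V hV using fun p hp => exists_metric_ne_zero hN (p := p) hp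
  -- The coefficient g(Y, V)/g(N, V) does not depend on V, because N has no zeros. Near `p` it can
  -- be computed with the single field `V p`, whence it is smooth.
  have hh : ∀ p ∈ U, ∀ q ∈ U, metric hN N (V p) q ≠ 0 →
      metric hN Y (V q) q / metric hN N (V q) q = metric hN Y (V p) q / metric hN N (V p) q := by
    intro p _ q hq hpq
    rw [div_eq_div_iff (hV q hq) hpq]
    have h1 : (metric hN Y (V q) q * metric hN N (V p) q) • N q =
        (metric hN Y (V p) q * metric hN N (V q) q) • N q := by
      rw [mul_comm, mul_smul, ← hkey, mul_comm, mul_smul, ← hkey, smul_comm]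
    exact smul_left_injective ℝ (hN q hq).2 h1
  refine Submodule.mem_span_singleton.2
    ⟨.mk (fun q => metric hN Y (V q) q / metric hN N (V q) q) fun p hp => ?_, ?_⟩
  · refine (((metric hN Y (V p)).contMDiffAt hp).div₀ ((metric hN N (V p)).contMDiffAt hp)
      (hV p hp)).congr_of_eventuallyEq ?_
    filter_upwards [((metric hN N (V p)).contMDiffAt hp).continuousAt.eventually_ne (hV p hp),
      U.isOpen.mem_nhds hp] with q hq hqU using hh p hp q hqU hq
  · refine VectorFields.ext_on fun q hq => ?_
    rw [VectorFields.smul_apply, SmoothFun.mk_apply, div_eq_inv_mul, mul_smul, ← hkey,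
      inv_smul_smul₀ (hV q hq)]

variable {D : VectorFields E U → VectorFields E U → VectorFields E U}

/-- For a metric torsion-free connection, the curvature maps `N^⊥` to multiples of `N` if and only
if it vanishes on `N^⊥`. -/
theorem curvature_mem_span_iff (hN : S.IsAdmissible N) (hD : IsLinearConnection D)
    (htor : ∀ X Y, D X Y - D Y X = lieBracket X Y)
    (hmet : ∀ X Y Z, dirDeriv X (metric hN Y Z) = metric hN (D X Y) Z + metric hN Y (D X Z)) :
    (∀ X Y, ∀ Z ∈ S.Perp N, curvature D X Y Z ∈ Submodule.span (SmoothFun E U) {N}) ↔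
      ∀ X ∈ S.Perp N, ∀ Y ∈ S.Perp N, ∀ Z ∈ S.Perp N, curvature D X Y Z = 0 := by
  have hsymm := metric_symm hN
  constructor
  · intro h X hX Y hY Z _
    refine metric_nondegenerate hN fun W => ?_
    -- After the exchange of pairs, `X` is the differentiated section, and R(Z, W)X is a multiple of
    -- N, orthogonal to `Y`.
    obtain ⟨c, hc⟩ := Submodule.mem_span_singleton.1 (h Z W X hX)
    rw [curvature_pair_symm hD hsymm htor hmet, ← hc, map_smul, LinearMap.smul_apply,
      (mem_perp_iff hN Y).1 hY, smul_zero]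
  · intro h X Y Z hZ
    refine mem_span_of_forall_perp hN fun W hW => ?_
    rw [curvature_pair_symm hD hsymm htor hmet]
    have hanti : ∀ X Y, metric hN (curvature D Z W X) Y = -metric hN (curvature D Z W Y) X :=
      fun X Y => by rw [curvature_metric_swap hmet, hsymm]
    have hself : ∀ X, metric hN (curvature D Z W X) X = 0 := fun X => by
      linear_combination (SmoothFun.half : SmoothFun E U) * hanti X X
        - (metric hN (curvature D Z W X) X) * SmoothFun.two_mul_half (E := E) (U := U)
    -- R(Z, W) kills g(N, Y)X - g(N, X)Y, which lies in N^⊥. Pairing with Y removes the second term,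
    -- since R(Z, W) is skew.
    have hmul : ∀ X Y, metric hN N Y * metric hN (curvature D Z W X) Y = 0 := fun X Y => by
      have h1 := h Z hZ W hW _ (smul_sub_smul_mem_perp hN X Y)
      rw [hD.curvature_sub_right, hD.curvature_smul_right, hD.curvature_smul_right] at h1
      have h2 := congrArg (fun T => metric hN T Y) h1
      simp only [map_sub, map_smul, LinearMap.sub_apply, LinearMap.smul_apply, smul_eq_mul,
        map_zero, LinearMap.zero_apply, hself, mul_zero, sub_zero] at h2
      exact h2
    have hpt : ∀ p X Y, metric hN N Y p ≠ 0 → metric hN (curvature D Z W X) Y p = 0 :=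
      fun p X Y hne => (mul_eq_zero.1
        (congrArg (fun f : SmoothFun E U => f p) (hmul X Y))).resolve_left hne
    ext p
    by_cases hp : p ∈ U
    -- Where g(N, Y) vanishes, choose V with g(N, V) nonzero: the form vanishes on (X, V) and on (X,
    -- Y + V), hence on (X, Y).
    · by_cases hb : metric hN N Y p = 0
      · obtain ⟨V, hV⟩ := exists_metric_ne_zero hN hp
        have h1 := hpt p X V hV
        have h2 := hpt p X (Y + V) (by rwa [map_add, SmoothFun.add_apply, hb, zero_add])
        rwa [map_add, SmoothFun.add_apply, h1, add_zero] at h2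
      · exact hpt p X Y hb
    · rw [linearMap_apply_of_notMem _ hp]
      rfl

end PPWave

end FinslerSpacetime

end FinslerPP

/-! ### The induced metric and connection, and flatness -/

open FinslerPP in
theorem theorem5p1
    {E : Type*} [NormedAddCommGroup E] [NormedSpace ℝ E] [FiniteDimensional ℝ E]
    {M : Type*} [TopologicalSpace M] [ChartedSpace E M] [IsManifold 𝓘(ℝ, E) ∞ M]
    [T2Space M] [SecondCountableTopology M] [ConnectedSpace M]
    (S : FinslerSpacetime E M) (U : Opens M)
    (f : SmoothFun E U) (N : VectorFields E U)
    (hgrad : S.IsGradient f N) (hlight : S.IsLightlike N) (hpar : S.IsParallel N) :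
    -- the positive definite metric `ḡ([x], [y]) = -g_N(x, y)` on the bundle `N^⊥/N`
    (∃ gbar : (p : U) → LinearMap.BilinForm ℝ (S.QuotFibre N p),
      (∀ (p : U) (x y : S.PerpFibre N p),
        gbar p (Submodule.Quotient.mk x) (Submodule.Quotient.mk y) = -S.g N p x y) ∧
      (∀ p ξ η, gbar p ξ η = gbar p η ξ) ∧
      (∀ p ξ, ξ ≠ 0 → 0 < gbar p ξ ξ) ∧
      -- the metric is smooth on sections
      (∀ X ∈ S.Perp N, ∀ Y ∈ S.Perp N,
        ContMDiffOn 𝓘(ℝ, E) 𝓘(ℝ, ℝ) ∞ (fun p => -S.g N p (X p) (Y p)) U)) ∧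
    -- the connection `∇̄_W [Y] = [∇^N_W Y]` on the bundle `N^⊥/N`
    (∃ Dbar : VectorFields E U → S.QuotSections N → S.QuotSections N,
      IsLinearConnection Dbar ∧
      (∀ (W : VectorFields E U) (Y : S.Perp N),
        ∃ h : S.chern N W Y ∈ S.Perp N,
          Dbar W (Submodule.Quotient.mk Y) = Submodule.Quotient.mk ⟨S.chern N W Y, h⟩) ∧
      (IsFlat Dbar ↔ S.IsPPWave N)) := by
  have hN := hgrad.1
  have hC := FinslerSpacetime.isChernConnection_chern hgrad hlight
  have hmet := FinslerSpacetime.dirDeriv_metric_of_isParallel hN hC hpar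
  constructor
  · obtain ⟨gbar, h1, h2, h3⟩ := FinslerSpacetime.exists_metric_bar hlight
    exact ⟨gbar, h1, h2, h3, fun X _ Y _ p hp =>
      ((-FinslerSpacetime.metric hN X Y).contMDiffAt hp).contMDiffWithinAt⟩
  have hperp : ∀ W, ∀ Y ∈ S.Perp N, S.chern N W Y ∈ S.Perp N := fun W Y hY => by
    have h := hmet W N Y
    rw [(FinslerSpacetime.mem_perp_iff hN Y).1 hY, dirDeriv_zero, hpar W, map_zero,
      LinearMap.zero_apply, zero_add] at h
    exact (FinslerSpacetime.mem_perp_iff hN _).2 h.symm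
  have hR := hC.linear.restrictConnection (S.Perp N) hperp
  have hspan : ∀ W, ∀ Y ∈ (Submodule.span (SmoothFun E U) {N}).submoduleOf (S.Perp N),
      restrictConnection (S.Perp N) hperp W Y ∈
        (Submodule.span (SmoothFun E U) {N}).submoduleOf (S.Perp N) := fun W Y hY => by
    obtain ⟨h, hh⟩ := Submodule.mem_span_singleton.1 (Submodule.mem_comap.1 hY)
    -- By the Leibniz rule and parallelism, the derivative of hN along W is W(h)N.
    refine Submodule.mem_comap.2 (Submodule.mem_span_singleton.2 ⟨dirDeriv W h, ?_⟩)
    have h1 := hC.linear.leibniz W h N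
    rw [hpar W, smul_zero, zero_add] at h1
    rw [← h1, hh]
    rfl
  refine ⟨quotientConnection (restrictConnection (S.Perp N) hperp) _,
    hR.quotientConnection hspan, fun W Y => ⟨hperp W Y Y.2, quotientConnection_mk hR hspan W Y⟩, ?_⟩
  rw [isFlat_quotientConnection_iff hR hspan]
  have hiff := FinslerSpacetime.curvature_mem_span_iff hN hC.linear hC.torsion_free hmet
  constructor
  · intro h
    exact ⟨⟨f, hgrad⟩, hlight, hpar, hiff.1 fun X Y Z hZ => h X Y ⟨Z, hZ⟩⟩
  · exact fun h X Y Z => hiff.2 h.2.2.2 X Y Z Z.2
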